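/- Let $X$ be a smooth manifold with tangent bundle $T$, let $q\ge 1$, and let $\mathcal F\to X$ be a natural bundle of order $q$: it is patched from products of chart domains with a smooth manifold $N$ through $\bar x=\varphi(x)$, $\bar u=\lambda(u,j_q(\varphi)(x))$, where $\lambda$ is a smooth action on $N$ of the invertible $q$-jets (derivatives of orders $1,\dots,q$), compatible with composition. For a smooth section $\omega$ of $\mathcal F$ (a geometric object), $\xi_q\in J_q(T)$ over $\xi\in T$ and $L^{\tau\mu}_k=\partial\lambda^\tau/\partial y^k_\mu$ at the identity jet, put $$(L(\xi_q)\omega)^\tau=-L^{\tau\mu}_k(\omega(x))\,\xi^k_\mu+\xi^r\partial_r\omega^\tau(x)\in\omega^{-1}(V(\mathcal F)),\qquad 1\le|\mu|\le q,$$ $R_q=\{\xi_q\in J_q(T)\mid L(\xi_q)\omega=0\}$ and $R_q^0=\ker(R_q\to T)$. Let $\omega_0$ be a smooth section of $\mathcal F$ (the special section; $\omega_0=\omega$ is allowed), let $\Pi_q$ be the bundle of $q$-jets of local diffeomorphisms of $X$, and let $\mathcal B_1\subset J_1(\mathcal F)$ be the image of $\Pi_{q+1}\to J_1(\mathcal F)$,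 $j_{q+1}(f)(x)\mapsto j_1(j_q(f)^{-1}(\omega_0))(x)$. Assume: 1. every jet $f_q\in\Pi_q$ with $f_q^{-1}(\omega_0)=\omega_0$ lifts to some $f_{q+1}\in\Pi_{q+1}$ whose image in $J_1(\mathcal F)$ is $j_1(\omega_0)$ (this holds whenever the system $\{f_q^{-1}(\omega_0)=\omega_0\}$ is formally integrable, in particular if it is involutive); 2. $\omega$ takes its values in the image of $\Pi_q\to\mathcal F$, $f_q\mapsto f_q^{-1}(\omega_0)$ (automatic for $\omega=\omega_0$); 3. $R_q$ is transitive, i.e. $R_q\to T$ is an epimorphism; 4. $J_q(T)\to\omega^{-1}(V(\mathcal F))$, $\xi_q\mapsto L(\xi_q)\omega$, is an epimorphism. Let $\delta:S_{q+1}T^*\otimes T\to T^*\otimes S_qT^*\otimes T\subset T^*\otimes J_q(T)$ be the Spencer map, $(\delta\zeta)^k_{\mu,i}=\zeta^k_{\mu+1_i}$ ($|\mu|=q$), and $$A(R_q^0)=\{\chi_q\in T^*\otimes J_q(T)/(T^*\otimes R_q^0+\delta(S_{q+1}T^*\otimes T))\mid\chi_0=\mathrm{id}_T\}.$$ Then $T^*\otimes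 R_q^0+\delta(S_{q+1}T^*\otimes T)$ has locally constant rank, the fibre of $\mathcal B_1$ over each point $\omega(x)$ is a nonempty affine subspace of the fibre of $J_1(\mathcal F)$, and, with $\omega^{-1}(J_1(\mathcal F)/\mathcal B_1)$ denoting the quotient of $\omega^{-1}(J_1(\mathcal F))$ by the directions of these affine subspaces, $$A(R_q^0)\simeq\omega^{-1}(J_1(\mathcal F)/\mathcal B_1),\qquad[\chi_q]\mapsto[\,j_1(\omega)+L(\chi_q)\omega\,],$$ is a well defined isomorphism of affine bundles over $X$: it is an affine bijection on every fibre, it is compatible with the changes of charts of $X$, and a section of $A(R_q^0)$ is smooth (locally represented by a smooth $\chi_q$ with $\chi_0=\mathrm{id}_T$) if and only if its image is smooth (locally represented by a smooth section of $J_1(\mathcal F)$ over $\omega$). -/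

import Mathlib

open scoped Manifold ContDiff Topology

noncomputable section

namespace LieEq

/-! ### Jets in local coordinates

`E` is the model space of the base manifold `X`. Jets are recorded by their derivatives at the
base point, each derivative of order `k` being a symmetric `k`-linear map; in coordinates these
are the numbers `ξ^k_μ` with `μ` a multi-index. -/

section Jets

variable {E : Type*} [NormedAddCommGroup E] [NormedSpace ℝ E]

theorem iteratedFDeriv_succ_apply {n : ℕ} {f : E → E} {x : E} (h : ContDiffAt ℝ (n + 1 : ℕ) f x) (v : Fin (n+1) → E) :
   iteratedFDeriv ℝ (n+1) f x v = fderiv ℝ (fun y => iteratedFDeriv ℝ n f y (Fin.tail v)) x (v 0) := by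
  have hd : DifferentiableAt ℝ (iteratedFDeriv ℝ n f) x := by
    exact (h.iteratedFDeriv_right (m := 1) (i := n) (by norm_cast; omega)).differentiableAt (by simp)
  rw [iteratedFDeriv_succ_apply_left]
  have := (hd.hasFDerivAt.continuousMultilinear_apply_const (Fin.tail v))
  rw [this.fderiv]; rfl

theorem iteratedFDeriv_perm : ∀ (n : ℕ) {f : E → E} {x : E}, ContDiffAt ℝ n f x →
    ∀ (σ : Equiv.Perm (Fin n)) (v : Fin n → E),
      iteratedFDeriv ℝ n f x (v ∘ σ) = iteratedFDeriv ℝ n f x v := by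
  intro n
  induction n with
  | zero => 
    intro f x _ σ v
    rw [Subsingleton.elim (v ∘ σ) v]
  | succ n ih =>
    intro f x h σ
    have hσ : σ ∈ Submonoid.closure (Set.range fun i : Fin n => Equiv.swap i.castSucc i.succ) := by
      rw [Equiv.Perm.mclosure_swap_castSucc_succ]; trivial
    induction hσ using Submonoid.closure_induction with
    | one => intro v; rfl
    | mul a b _ _ ha hb =>
      intro v
      have : v ∘ ⇑(a * b) = (v ∘ a) ∘ b := rfl
      rw [this, hb, ha]
    | mem a ha =>
      obtain ⟨i, rfl⟩ := ha
      intro v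
      cases n with
      | zero => exact i.elim0
      | succ n =>
      refine Fin.cases ?_ (fun j => ?_) i
      · have h2 : ContDiffAt ℝ 2 (iteratedFDeriv ℝ n f) x :=
          h.iteratedFDeriv_right (m := 2) (i := n) (by norm_cast; omega)
        have hs : IsSymmSndFDerivAt ℝ (iteratedFDeriv ℝ n f) x :=
          h2.isSymmSndFDerivAt (by simp)
        have key : ∀ w : Fin (n + 2) → E, iteratedFDeriv ℝ (n + 2) f x w =
            fderiv ℝ (fderiv ℝ (iteratedFDeriv ℝ n f)) x (w 0) (w 1) (Fin.tail (Fin.tail w)) := by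
          intro w
          have hd : DifferentiableAt ℝ (fderiv ℝ (iteratedFDeriv ℝ n f)) x :=
            (h2.fderiv_right (m := 1) (by norm_num)).differentiableAt (by simp)
          rw [iteratedFDeriv_succ_apply h]
          have e : (fun y => iteratedFDeriv ℝ (n + 1) f y (Fin.tail w)) = fun y =>
              fderiv ℝ (iteratedFDeriv ℝ n f) y (w 1) (Fin.tail (Fin.tail w)) := rfl
          rw [e]
          have h3 := (hd.hasFDerivAt.clm_apply (hasFDerivAt_const (w 1) x))
          have h4 := h3.continuousMultilinear_apply_const (Fin.tail (Fin.tail w))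
          rw [h4.fderiv]
          simp
        have hv : Fin.tail (Fin.tail (v ∘ ⇑(Equiv.swap (0 : Fin (n + 1)).castSucc
            (0 : Fin (n + 1)).succ))) = Fin.tail (Fin.tail v) := by
          funext j
          change v (Equiv.swap _ _ j.succ.succ) = v j.succ.succ
          rw [Equiv.swap_apply_of_ne_of_ne]
          · simp
          · simp [Fin.ext_iff]
        rw [key, key, hv]
        have e0 : (v ∘ ⇑(Equiv.swap (0 : Fin (n + 1)).castSucc (0 : Fin (n + 1)).succ)) 0 = v 1 :=
          congrArg v (Equiv.swap_apply_left _ _)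
        have e1 : (v ∘ ⇑(Equiv.swap (0 : Fin (n + 1)).castSucc (0 : Fin (n + 1)).succ)) 1 = v 0 :=
          congrArg v (Equiv.swap_apply_right _ _)
        rw [e0, e1, hs.eq]
      · rw [iteratedFDeriv_succ_apply h, iteratedFDeriv_succ_apply h]
        have e0 : (v ∘ ⇑(Equiv.swap j.succ.castSucc j.succ.succ)) 0 = v 0 := by
          change v (Equiv.swap _ _ 0) = v 0
          rw [Equiv.swap_apply_of_ne_of_ne] <;> simp [Fin.ext_iff]
        have e1 : Fin.tail (v ∘ ⇑(Equiv.swap j.succ.castSucc j.succ.succ)) =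
            Fin.tail v ∘ ⇑(Equiv.swap j.castSucc j.succ) := by
          funext i
          change v (Equiv.swap _ _ i.succ) = v (Equiv.swap j.castSucc j.succ i).succ
          congr 1
          rw [← Fin.succ_castSucc]
          exact ((Fin.succ_injective _).swap_apply _ _ _)
        rw [e0, e1]
        congr 1
        apply Filter.EventuallyEq.fderiv_eq
        filter_upwards [h.eventually (by simp)] with y hy
        exact ih (hy.of_le (by norm_cast; omega)) _ _

variable (E)

/-- Fibre of `S_k T* ⊗ T` in a chart: symmetric `k`-linear maps from `E` to `E`. -/
def SymMap (k : ℕ) : Submodule ℝ (ContinuousMultilinearMap ℝ (fun _ : Fin k => E) E) where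
  carrier := {p | ∀ (σ : Equiv.Perm (Fin k)) (v : Fin k → E), p (v ∘ σ) = p v}
  zero_mem' := by intro σ v; rfl
  add_mem' := by
    intro p p' hp hp' σ v
    simp [hp σ v, hp' σ v]
  smul_mem' := by
    intro c p hp σ v
    simp [hp σ v]

instance (k : ℕ) : NormedAddCommGroup (SymMap E k) := Submodule.normedAddCommGroup _

instance (k : ℕ) : NormedSpace ℝ (SymMap E k) := Submodule.normedSpace _

/-- Fibre of `J_q(T)` in a chart: all derivatives `ξ_μ` with `0 ≤ |μ| ≤ q`. -/
abbrev Jet (q : ℕ) : Type _ := (k : Fin (q + 1)) → SymMap E (k : ℕ)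

/-- The derivatives `y_μ` with `1 ≤ |μ| ≤ q` only (no source, no target). -/
abbrev JetP (q : ℕ) : Type _ := (k : Fin q) → SymMap E ((k : ℕ) + 1)

variable {E}

instance (q : ℕ) : NormedAddCommGroup (Jet E q) := Pi.normedAddCommGroup

instance (q : ℕ) : NormedSpace ℝ (Jet E q) := Pi.normedSpace

instance (q : ℕ) : NormedAddCommGroup (JetP E q) := Pi.normedAddCommGroup

instance (q : ℕ) : NormedSpace ℝ (JetP E q) := Pi.normedSpace

/-- The part of order zero of a jet: the projection `π^q_0 : J_q(T) → T`. -/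
def Jet.low {q : ℕ} : Jet E q →ₗ[ℝ] E where
  toFun ξ := (ξ 0).1 (fun _ => 0)
  map_add' _ _ := rfl
  map_smul' _ _ := rfl

/-- The part of order at least one of a jet. -/
def Jet.high {q : ℕ} : Jet E q →ₗ[ℝ] JetP E q where
  toFun ξ := fun k => ξ k.succ
  map_add' _ _ := rfl
  map_smul' _ _ := rfl

/-- The derivative of order `k` of `f` at `x` (and `0` if `f` is not smooth at `x`). -/
def symDeriv (k : ℕ) (f : E → E) (x : E) : SymMap E k :=
  open Classical in
  if h : ContDiffAt ℝ ∞ f x then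
    ⟨iteratedFDeriv ℝ k f x, fun σ v => by
      exact iteratedFDeriv_perm k (h.of_le (by exact_mod_cast le_top)) σ v⟩
  else 0

/-- The `q`-jet at `x` of a vector field `ξ`, written in a chart. -/
def jet (q : ℕ) (ξ : E → E) (x : E) : Jet E q := fun k => symDeriv (k : ℕ) ξ x

/-- The derivatives of orders `1, …, q` at `x` of a map `f`. -/
def jetP (q : ℕ) (f : E → E) (x : E) : JetP E q := fun k => symDeriv ((k : ℕ) + 1) f x

/-- The jet coordinates of `id_q`. -/
def idJet (E : Type*) [NormedAddCommGroup E] [NormedSpace ℝ E] (q : ℕ) : JetP E q :=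
  jetP q (fun x => x) 0

/-- Jets with invertible first order part, `det (y^k_i) ≠ 0`. -/
def regular (E : Type*) [NormedAddCommGroup E] [NormedSpace ℝ E] (q : ℕ) : Set (JetP E q) :=
  {a | ∀ h : 0 < q, Function.Bijective fun v : E =>
    (a ⟨0, h⟩ : ContinuousMultilinearMap ℝ (fun _ : Fin (0 + 1) => E) E) (fun _ => v)}

/-- The polynomial vector field with `q`-jet `ξ` at `x`. -/
def taylor {q : ℕ} (ξ : Jet E q) (x : E) : E → E := fun y =>
  ∑ k : Fin (q + 1), ((Nat.factorial (k : ℕ) : ℝ)⁻¹) •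
    (ξ k : ContinuousMultilinearMap ℝ (fun _ : Fin (k : ℕ) => E) E) (fun _ => y - x)

/-- Local diffeomorphisms of the model space. -/
def IsLocDiff (h : OpenPartialHomeomorph E E) : Prop :=
  ContDiffOn ℝ ∞ h h.source ∧ ContDiffOn ℝ ∞ h.symm h.target

/-- Change of coordinates in `J_q(T)`: for a change of coordinates `g`, the jet at `g x` of the
image under `g` of a vector field with jet `ξ` at `x`. -/
def pushJet {q : ℕ} (g : OpenPartialHomeomorph E E) (x : E) (ξ : Jet E q) : Jet E q :=
  jet q (fun y => fderiv ℝ g (g.symm y) (taylor ξ x (g.symm y))) (g x)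

variable [FiniteDimensional ℝ E]

/-- Contraction of a symmetric map with a vector: `ζ_{μ+1_i} v^i` for `|μ| = k`. -/
def SymMap.contract (k : ℕ) (ζ : SymMap E (k + 1)) : E →ₗ[ℝ] SymMap E k where
  toFun v := ⟨ζ.1.curryLeft v, by
    intro σ w
    have := ζ.2 (Equiv.Perm.decomposeFin.symm (0, σ)) (Fin.cons v w)
    rw [ContinuousMultilinearMap.curryLeft_apply, ContinuousMultilinearMap.curryLeft_apply,
      ← this]
    congr 1
    funext i
    refine Fin.cases ?_ (fun j => ?_) i <;> simp⟩
  map_add' v w := by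
    ext u
    simp
  map_smul' c v := by
    ext u
    simp

/-- The Spencer map `δ : S_{q+1}T* ⊗ T → T* ⊗ S_qT* ⊗ T ⊆ T* ⊗ J_q(T)`,
`(δζ)_{μ,i} = ζ_{μ+1_i}` for `|μ| = q`, all the components with `|μ| < q` being zero. -/
def delta (q : ℕ) : SymMap E (q + 1) →ₗ[ℝ] (E →L[ℝ] Jet E q) where
  toFun ζ := LinearMap.toContinuousLinearMap
    (LinearMap.single ℝ (fun k : Fin (q + 1) => SymMap E (k : ℕ)) (Fin.last q) ∘ₗ
      SymMap.contract q ζ)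
  map_add' ζ ζ' := by
    have h : SymMap.contract q (ζ + ζ') = SymMap.contract q ζ + SymMap.contract q ζ' := rfl
    rw [h, LinearMap.comp_add, map_add]
  map_smul' c ζ := by
    have h : SymMap.contract q (c • ζ) = c • SymMap.contract q ζ := rfl
    rw [h, LinearMap.comp_smul, map_smul, RingHom.id_apply]

/-- The fibre of `id_T^{-1}(T* ⊗ J_q(T))`: the `J_q(T)`-valued 1-forms `χ_q` with `χ_0 = id_T`. -/
def connections (E : Type*) [NormedAddCommGroup E] [NormedSpace ℝ E] (q : ℕ) :
    AffineSubspace ℝ (E →L[ℝ] Jet E q) where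
  carrier := {χ | ∀ v, (χ v).low = v}
  smul_vsub_vadd_mem' := by
    intro c p₁ p₂ p₃ h₁ h₂ h₃ v
    have e₁ : (p₁ v).low = v := h₁ v
    have e₂ : (p₂ v).low = v := h₂ v
    have e₃ : (p₃ v).low = v := h₃ v
    simp [e₁, e₂, e₃]

/-- A vector as a jet of order zero. -/
def SymMap.const : E →ₗ[ℝ] SymMap E 0 where
  toFun v := ⟨ContinuousMultilinearMap.constOfIsEmpty ℝ (fun _ : Fin 0 => E) v, fun _ _ => rfl⟩
  map_add' _ _ := rfl
  map_smul' _ _ := rfl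

theorem connections_nonempty (q : ℕ) : ∃ χ : E →L[ℝ] Jet E q, χ ∈ connections E q :=
  ⟨LinearMap.toContinuousLinearMap
    (LinearMap.single ℝ (fun k : Fin (q + 1) => SymMap E (k : ℕ)) 0 ∘ₗ SymMap.const),
    fun _ => rfl⟩

end Jets

/-! ### Natural bundles and geometric objects -/

section Natural

variable (E : Type*) [NormedAddCommGroup E] [NormedSpace ℝ E]
  {EN : Type*} [NormedAddCommGroup EN] [NormedSpace ℝ EN]
  (N : Type*) [TopologicalSpace N] [ChartedSpace EN N]

/-- The data defining a natural bundle of order `q` with typical fibre `N`: the transition law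
`ū = λ(u, j_q(φ)(x))`, that is, a smooth action on `N` of the invertible `q`-jets. The natural
bundle over `X` is obtained by patching the products of chart domains with `N` through the changes
of coordinates `x̄ = φ(x)`, `ū = λ(u, j_q(φ)(x))`. -/
structure NaturalLaw (q : ℕ) where
  /-- `act a u` is `λ(u, a)`. -/
  act : JetP E q → N → N
  smooth : ContMDiffOn (𝓘(ℝ, JetP E q).prod 𝓘(ℝ, EN)) 𝓘(ℝ, EN) ∞
    (fun p : JetP E q × N => act p.1 p.2) (regular E q ×ˢ Set.univ)
  act_id : ∀ u, act (idJet E q) u = u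
  act_comp : ∀ (g f : OpenPartialHomeomorph E E) (x : E) (u : N), IsLocDiff g → IsLocDiff f →
    x ∈ f.source → f x ∈ g.source →
    act (jetP q (fun y => g (f y)) x) u = act (jetP q g (f x)) (act (jetP q f x) u)

variable {E N}

/-- A point of `J_1(F)` over a given point of `X`, in a chart: `(u^τ, u^τ_i)`. -/
abbrev OneJet (E : Type*) [NormedAddCommGroup E] [NormedSpace ℝ E]
    {EN : Type*} [NormedAddCommGroup EN] [NormedSpace ℝ EN]
    (N : Type*) [TopologicalSpace N] [ChartedSpace EN N] : Type _ :=
  Σ u : N, E →L[ℝ] TangentSpace 𝓘(ℝ, EN) u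

/-- The derivative `∂_i s(z)` of the local expression `s` of a section. -/
def dsec (s : E → N) (z : E) : E →L[ℝ] TangentSpace 𝓘(ℝ, EN) (s z) :=
  mfderiv 𝓘(ℝ, E) 𝓘(ℝ, EN) s z

/-- `j_1(s)(z) = (s(z), ∂_i s(z))`. -/
def j1 (s : E → N) (z : E) : OneJet E (EN := EN) N :=
  ⟨s z, dsec s z⟩

namespace NaturalLaw

variable {q : ℕ} (lam : NaturalLaw E (EN := EN) N q)

/-- `ξ ↦ L^{τμ}_k(u) ξ^k_μ` (`1 ≤ |μ| ≤ q`): the derivative of `λ` at the identity jet. The value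
lies over `λ(u, id_q) = u`. -/
def inf (u : N) : JetP E q →L[ℝ] TangentSpace 𝓘(ℝ, EN) u :=
  mfderiv 𝓘(ℝ, JetP E q) 𝓘(ℝ, EN) (fun a : JetP E q => lam.act a u) (idJet E q)

/-- The formal Lie derivative of the section `s`,
`L(ξ_q)s = - L^{τμ}_k(s(z)) ξ^k_μ + ξ^r ∂_r s^τ(z)`, at `z`. -/
def lie (s : E → N) (z : E) : Jet E q →ₗ[ℝ] TangentSpace 𝓘(ℝ, EN) (s z) :=
  (dsec (EN := EN) s z : E →ₗ[ℝ] TangentSpace 𝓘(ℝ, EN) (s z)) ∘ₗ Jet.low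
    - (lam.inf (s z) : JetP E q →ₗ[ℝ] TangentSpace 𝓘(ℝ, EN) (s z)) ∘ₗ Jet.high

/-- Inverse image `f^{-1}(s)` of a section `s` by a local diffeomorphism `f`:
`w ↦ λ(s(f(w)), j_q(f^{-1})(f(w)))`. -/
def pull (f : OpenPartialHomeomorph E E) (s : E → N) : E → N := fun w =>
  lam.act (jetP q f.symm (f w)) (s (f w))

/-- Change of coordinates in `J_1(F)` for the change of coordinates `g` at `z`:
`ū = λ(u, j_q(g)(z))`, `ū_r ∂_i g^r = ∂/∂z^i λ(u, j_q(g)(z)) + ∂λ/∂u u_i`. -/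
def pushOneJet (g : OpenPartialHomeomorph E E) (z : E) (t : OneJet E (EN := EN) N) :
    OneJet E (EN := EN) N :=
  ⟨lam.act (jetP q g z) t.1,
    (dsec (EN := EN) (fun w => lam.act (jetP q g w) t.1) z +
      (mfderiv 𝓘(ℝ, EN) 𝓘(ℝ, EN) (lam.act (jetP q g z)) t.1).comp t.2).comp
      (fderiv ℝ g.symm (g z))⟩

/-- The fibre of `R_q = {ξ_q ∈ J_q(T) | L(ξ_q)s = 0}`. -/
def Rq (s : E → N) (z : E) : Submodule ℝ (Jet E q) := LinearMap.ker (lam.lie s z)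

/-- The fibre of `R^0_q`, the kernel of `R_q → T`. -/
def R0 (s : E → N) (z : E) : Submodule ℝ (Jet E q) := lam.Rq s z ⊓ LinearMap.ker Jet.low

/-- The fibre of `T* ⊗ R^0_q`. -/
def formsR0 (s : E → N) (z : E) : Submodule ℝ (E →L[ℝ] Jet E q) where
  carrier := {χ | ∀ v, χ v ∈ lam.R0 s z}
  zero_mem' := fun _ => Submodule.zero_mem _
  add_mem' := fun h h' v => Submodule.add_mem _ (h v) (h' v)
  smul_mem' := fun c _ h v => Submodule.smul_mem _ c (h v)

variable [FiniteDimensional ℝ E]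

/-- The fibre of `T* ⊗ R^0_q + δ(S_{q+1}T* ⊗ T)`. -/
def W (s : E → N) (z : E) : Submodule ℝ (E →L[ℝ] Jet E q) :=
  lam.formsR0 s z ⊔ LinearMap.range (delta (E := E) q)

/-- The fibre of the affine bundle
`A(R^0_q) = {χ_q ∈ T* ⊗ J_q(T) / (T* ⊗ R^0_q + δ(S_{q+1}T* ⊗ T)) | χ_0 = id_T}`. -/
def A (s : E → N) (z : E) : AffineSubspace ℝ ((E →L[ℝ] Jet E q) ⧸ lam.W s z) :=
  (connections E q).map (lam.W s z).mkQ.toAffineMap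

/-- The class in `A(R^0_q)` of a 1-form `χ_q` with `χ_0 = id_T`. -/
def cls (s : E → N) (z : E) (χ : E →L[ℝ] Jet E q) (h : χ ∈ connections E q) : lam.A s z :=
  ⟨(lam.W s z).mkQ χ, ⟨χ, h, rfl⟩⟩

instance (s : E → N) (z : E) : Nonempty (lam.A s z) :=
  let ⟨χ, h⟩ := connections_nonempty (E := E) q
  ⟨lam.cls s z χ h⟩

/-- The representative `j_1(s) + L(χ_q)s` in `J_1(F)`, over `s(z)`. -/
def rep (s : E → N) (z : E) (χ : E →L[ℝ] Jet E q) : E →L[ℝ] TangentSpace 𝓘(ℝ, EN) (s z) :=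
  dsec (EN := EN) s z +
    LinearMap.toContinuousLinearMap (lam.lie s z ∘ₗ (χ : E →ₗ[ℝ] Jet E q))

end NaturalLaw

variable {q : ℕ} (lam : NaturalLaw E (EN := EN) N q)
  (X : Type*) [TopologicalSpace X] [ChartedSpace E X]

/-- The charts of the smooth manifold `X`. -/
abbrev Chart (E : Type*) [NormedAddCommGroup E] [NormedSpace ℝ E]
    (X : Type*) [TopologicalSpace X] [ChartedSpace E X] : Type _ :=
  {e : OpenPartialHomeomorph X E // e ∈ IsManifold.maximalAtlas 𝓘(ℝ, E) ∞ X}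

/-- A geometric object: a smooth section of the natural bundle `F` over `X` with law `λ`, given by
its expressions in the charts of `X`, with `ω₀̄(φ(x)) = λ(ω₀(x), j_q(φ)(x))`. -/
structure GeometricObject where
  /-- the expression of the section in a chart -/
  expr : Chart E X → E → N
  smooth : ∀ e : Chart E X, ContMDiffOn 𝓘(ℝ, E) 𝓘(ℝ, EN) ∞ (expr e) e.1.target
  compat : ∀ (e e' : Chart E X) (x : X), x ∈ e.1.source → x ∈ e'.1.source →
    expr e' (e'.1 x) = lam.act (jetP q (e.1.symm.trans e'.1) (e.1 x)) (expr e (e.1 x))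

namespace GeometricObject

variable {lam X} (ω₀ : GeometricObject lam X)

/-- `R_q` is transitive: `π^q_0 : R_q → T` is an epimorphism. -/
def Transitive : Prop :=
  ∀ (e : Chart E X), ∀ z ∈ e.1.target, ∀ v : E, ∃ ξ ∈ lam.Rq (ω₀.expr e) z, Jet.low ξ = v

/-- `J_q(T) → F_0 = ω₀^{-1}(V(F))`, `ξ_q ↦ L(ξ_q)ω₀`, is an epimorphism. -/
def Epi : Prop :=
  ∀ (e : Chart E X), ∀ z ∈ e.1.target, Function.Surjective (lam.lie (ω₀.expr e) z)

/-- Over the point with coordinates `z` in a chart, the image `B_1` of the first prolongation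
`ρ_1(Φ_ω₀) : Π_{q+1} → J_1(F)`, `j_{q+1}(f)(z) ↦ j_1(j_q(f)^{-1}(ω₀))(z)`. The local diffeomorphism
`f` of `X` is written in that chart at the source and in a chart `e'` at the target. -/
def B1 (z : E) : Set (OneJet E (EN := EN) N) :=
  {t | ∃ (e' : Chart E X) (f : OpenPartialHomeomorph E E), IsLocDiff f ∧ z ∈ f.source ∧
    f z ∈ e'.1.target ∧ t = j1 (lam.pull f (ω₀.expr e')) z}

/-- The fibre of `B_1 ⊆ J_1(F)` over the point `(z, u)` of `F`. -/
def B1Fibre (z : E) (u : N) : Set (E →L[ℝ] TangentSpace 𝓘(ℝ, EN) u) :=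
  {σ | (⟨u, σ⟩ : OneJet E (EN := EN) N) ∈ ω₀.B1 z}

/-- The section `η` of `F` takes its values in the image of
`Φ_ω₀ : Π_q → F, f_q ↦ f_q^{-1}(ω₀)`. -/
def Reaches (η : GeometricObject lam X) : Prop :=
  ∀ (e : Chart E X), ∀ z ∈ e.1.target, ∃ (e' : Chart E X) (f : OpenPartialHomeomorph E E),
    IsLocDiff f ∧ z ∈ f.source ∧ f z ∈ e'.1.target ∧ lam.pull f (ω₀.expr e') z = η.expr e z

/-- The finite system `{f_q ∈ Π_q | f_q^{-1}(ω₀) = ω₀}` has the property that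
its first prolongation, `{f_{q+1} ∈ Π_{q+1} | j_1(f^{-1}(ω₀)) = j_1(ω₀)}`, projects onto it. -/
def ProlongationOnto : Prop :=
  ∀ (e e' : Chart E X) (f : OpenPartialHomeomorph E E) (z : E), z ∈ e.1.target →
    IsLocDiff f → z ∈ f.source → f z ∈ e'.1.target →
    lam.pull f (ω₀.expr e') z = ω₀.expr e z →
    ∃ f' : OpenPartialHomeomorph E E, IsLocDiff f' ∧ z ∈ f'.source ∧ f' z = f z ∧
      jetP q f' z = jetP q f z ∧
      j1 (EN := EN) (lam.pull f' (ω₀.expr e')) z = j1 (ω₀.expr e) z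

/-- The fibre of `η^{-1}(J_1(F)/B_1)`, where `B_1` is the image of `ρ_1(Φ_ω₀)`: the quotient of the
affine space of all `σ` over `η(z)` by the direction of the fibre of `B_1` over `η(z)`. -/
abbrev Q (η : GeometricObject lam X) (e : Chart E X) (z : E) : Type _ :=
  (E →L[ℝ] TangentSpace 𝓘(ℝ, EN) (η.expr e z)) ⧸ vectorSpan ℝ (ω₀.B1Fibre z (η.expr e z))

/-- The class of `σ`, a point of `J_1(F)` over `η(z)`, in `J_1(F)/B_1`. -/
def qcls (η : GeometricObject lam X) (e : Chart E X) (z : E)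
    (σ : E →L[ℝ] TangentSpace 𝓘(ℝ, EN) (η.expr e z)) : ω₀.Q η e z :=
  Submodule.Quotient.mk σ

/-- Smoothness at `z₀` of a section of `η^{-1}(J_1(F)/B_1)` over a chart domain: near `z₀` it is
the class of a smooth section of `J_1(F)` over `η`. -/
def SmoothAtQ [IsManifold 𝓘(ℝ, EN) ∞ N] (η : GeometricObject lam X) (e : Chart E X)
    (t : (z : e.1.target) → ω₀.Q η e z) (z₀ : E) : Prop :=
  ∃ (V : Set E) (σ : (z : E) → E →L[ℝ] TangentSpace 𝓘(ℝ, EN) (η.expr e z)),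
    IsOpen V ∧ z₀ ∈ V ∧
    (∀ v : E, ContMDiffOn 𝓘(ℝ, E) 𝓘(ℝ, EN).tangent ∞
      (fun z => (⟨η.expr e z, σ z v⟩ : TangentBundle 𝓘(ℝ, EN) N)) (V ∩ e.1.target)) ∧
    ∀ z : e.1.target, (z : E) ∈ V → t z = ω₀.qcls η e z (σ z)

variable [FiniteDimensional ℝ E]

/-- Smoothness at `z₀` of a section of `A(R^0_q)` over a chart domain: near `z₀` it is the class
of a smooth `J_q(T)`-valued 1-form `χ_q` with `χ_0 = id_T`. -/
def SmoothAtA (η : GeometricObject lam X) (e : Chart E X)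
    (c : (z : e.1.target) → lam.A (η.expr e) z) (z₀ : E) : Prop :=
  ∃ (V : Set E) (χ : E → E →L[ℝ] Jet E q) (h : ∀ z, χ z ∈ connections E q),
    IsOpen V ∧ z₀ ∈ V ∧ ContDiffOn ℝ ∞ χ (V ∩ e.1.target) ∧
    ∀ z : e.1.target, (z : E) ∈ V → c z = lam.cls (η.expr e) z (χ z) (h z)

end GeometricObject

end Natural

end LieEq

end

/-!
The fibre of `B_1` over a point of `F` and the submodule `T* ⊗ R^0_q + δ(S_{q+1}T* ⊗ T)` are both
governed by the symbol `ζ ↦ L^{τμ}_k ζ^k_{μ + 1_i}` (`NaturalLaw.symbol`), the composite of `L` with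
the Spencer map `δ` up to sign.

*Fibres of `B_1`.* Let `f` and `f₀` be local diffeomorphisms whose inverse images of `ω₀` have the
same value at a point. Then `f₀ ∘ f⁻¹` solves the system `f_q^{-1}(ω₀) = ω₀`, and by the hypothesis
on the prolongation its `q`-jet is also the `q`-jet of some `g'` preserving `j_1(ω₀)`. So
`f₀⁻¹ ∘ g' ∘ f` has the `q`-jet of the identity, and its derivative of order `q + 1` enters the
first jet of the inverse image through the symbol. Conversely every symmetric form is such a
derivative. Hence the fibre of `B_1` is an affine space directed by the image of the symbol
(`GeometricObject.b1Fibre_eq`).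

*The fibrewise isomorphism.* As `R_q → T` and `L` are onto, so is `χ ↦ (χ_0, L(χ)s)` on
`J_q(T)`-valued forms, and `T* ⊗ R^0_q + δ(S_{q+1}T* ⊗ T)` consists of the `χ` with `χ_0 = 0` and
`L(χ)s` in the image of the symbol (`NaturalLaw.mem_W_iff`). Forms with `χ_0 = id` modulo this
submodule are therefore the same as all of `T* ⊗ V(F)` modulo the image of the symbol
(`NaturalLaw.exists_affineEquiv`), and the rank of the submodule differs from that of the symbol by
a constant (`NaturalLaw.finrank_W`).

*Local constancy of the rank.* Transitivity of `R_q` and surjectivity of `L` make the infinitesimal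
action onto at `η(x)`, so the orbit of `η(x)` is a neighbourhood
(`NaturalLaw.eventually_mem_orbit`). The symbol is equivariant (`NaturalLaw.dFib_symbol`), so its
rank is constant on orbits.

*Changes of charts.* Let `h` be a local diffeomorphism and `h'` its conjugate by a change of charts
`g`, and let both sides of `g ∘ h = h' ∘ g` act on `N`. Differentiating in the base point when `h`
has the `q`-jet of the identity gives the equivariance of the symbol, and differentiating in the
parameter of a family generated by a vector field gives that of `L`
(`NaturalLaw.dJet_high_pushJet`).

*Smoothness.* The surjection `ξ ↦ (ξ_0, L(ξ)s)` depends smoothly on the point, hence has a smooth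
right inverse locally (`NaturalLaw.exists_contDiffOn_rep_eq`).
-/

noncomputable section

namespace LieEq

/-! ### Derivatives and jets of local diffeomorphisms -/

section Jets

variable {E : Type*} [NormedAddCommGroup E] [NormedSpace ℝ E]

/-- `f` is smooth on a neighbourhood of `x`. The condition `ContDiffAt ℝ ∞ f x` alone is weaker: the
neighbourhood on which `f` is `C^n` may shrink with `n`, whereas `symDeriv` asks for
`ContDiffAt ℝ ∞` at every point at which it is evaluated. -/
def SmoothNear (f : E → E) (x : E) : Prop := ∀ᶠ y in 𝓝 x, ContDiffAt ℝ ∞ f y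

theorem SmoothNear.contDiffAt {f : E → E} {x : E} (h : SmoothNear f x) : ContDiffAt ℝ ∞ f x :=
  h.self_of_nhds

theorem SmoothNear.eventually {f : E → E} {x : E} (h : SmoothNear f x) :
    ∀ᶠ y in 𝓝 x, SmoothNear f y := eventually_eventually_nhds.2 h

theorem SmoothNear.continuousAt {f : E → E} {x : E} (h : SmoothNear f x) : ContinuousAt f x :=
  h.contDiffAt.continuousAt

theorem SmoothNear.differentiableAt {f : E → E} {x : E} (h : SmoothNear f x) :
    DifferentiableAt ℝ f x := h.contDiffAt.differentiableAt (by simp)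

theorem SmoothNear.comp {g f : E → E} {x : E} (hg : SmoothNear g (f x)) (hf : SmoothNear f x) :
    SmoothNear (fun y => g (f y)) x := by
  filter_upwards [hf, hf.continuousAt.eventually hg] with y h1 h2
  exact h2.comp y h1

theorem SmoothNear.congr {f g : E → E} {x : E} (h : SmoothNear f x) (e : f =ᶠ[𝓝 x] g) :
    SmoothNear g x := by
  filter_upwards [h, eventually_eventually_nhds.2 e] with y h1 h2
  exact h1.congr_of_eventuallyEq (Filter.EventuallyEq.symm h2)

theorem _root_.ContDiff.smoothNear {f : E → E} (h : ContDiff ℝ ∞ f) (x : E) : SmoothNear f x :=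
  Filter.Eventually.of_forall fun _ => h.contDiffAt

theorem IsLocDiff.smoothNear {f : OpenPartialHomeomorph E E} (h : IsLocDiff f) {x : E}
    (hx : x ∈ f.source) : SmoothNear f x := by
  filter_upwards [f.open_source.mem_nhds hx] with y hy
  exact h.1.contDiffAt (f.open_source.mem_nhds hy)

theorem IsLocDiff.symm {f : OpenPartialHomeomorph E E} (h : IsLocDiff f) : IsLocDiff f.symm :=
  ⟨h.2, h.1⟩

theorem IsLocDiff.trans {f g : OpenPartialHomeomorph E E} (hf : IsLocDiff f) (hg : IsLocDiff g) :
    IsLocDiff (f.trans g) := by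
  constructor
  · intro x hx
    rw [OpenPartialHomeomorph.trans_source] at hx
    exact ((hg.1.contDiffAt (g.open_source.mem_nhds hx.2)).comp x
      (hf.1.contDiffAt (f.open_source.mem_nhds hx.1))).contDiffWithinAt
  · intro x hx
    rw [OpenPartialHomeomorph.trans_target] at hx
    exact ((hf.2.contDiffAt (f.open_target.mem_nhds hx.2)).comp x
      (hg.2.contDiffAt (g.open_target.mem_nhds hx.1))).contDiffWithinAt

theorem symDeriv_coe {f : E → E} {x : E} (h : ContDiffAt ℝ ∞ f x) (k : ℕ) :
    ((symDeriv k f x : SymMap E k) : ContinuousMultilinearMap ℝ (fun _ : Fin k => E) E) =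
      iteratedFDeriv ℝ k f x := by
  simp [symDeriv, h]

theorem symDeriv_congr {f g : E → E} {x : E} (e : f =ᶠ[𝓝 x] g) (k : ℕ) :
    symDeriv k f x = symDeriv k g x := by
  by_cases h : ContDiffAt ℝ ∞ f x
  · have h' : ContDiffAt ℝ ∞ g x := h.congr_of_eventuallyEq e.symm
    apply Subtype.ext
    rw [symDeriv_coe h, symDeriv_coe h', (e.iteratedFDeriv ℝ k).self_of_nhds]
  · have h' : ¬ ContDiffAt ℝ ∞ g x := fun h' => h (h'.congr_of_eventuallyEq e)
    simp [symDeriv, h, h']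

theorem jetP_congr {f g : E → E} {x : E} (e : f =ᶠ[𝓝 x] g) (q : ℕ) : jetP q f x = jetP q g x :=
  funext fun _ => symDeriv_congr e _

/-- The jet of a composite depends only on the jets of the two factors (Faà di Bruno). -/
theorem jetP_comp_congr {q : ℕ} {g g' f f' : E → E} {x : E} (hg : ContDiffAt ℝ ∞ g (f x))
    (hf : ContDiffAt ℝ ∞ f x) (hg' : ContDiffAt ℝ ∞ g' (f x)) (hf' : ContDiffAt ℝ ∞ f' x)
    (h0 : f' x = f x) (hff : jetP q f' x = jetP q f x) (hgg : jetP q g' (f x) = jetP q g (f x)) :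
    jetP q (fun y => g' (f' y)) x = jetP q (fun y => g (f y)) x := by
  have key : ∀ {u w : E → E} {y : E}, ContDiffAt ℝ ∞ u y → ContDiffAt ℝ ∞ w y →
      jetP q u y = jetP q w y → ∀ k, 0 < k → k ≤ q →
      iteratedFDeriv ℝ k u y = iteratedFDeriv ℝ k w y := by
    intro u w y hu hw e k hk hkq
    obtain ⟨k, rfl⟩ : ∃ j, k = j + 1 := ⟨k - 1, by omega⟩
    have := congrFun e ⟨k, hkq⟩
    have := congrArg Subtype.val this
    simpa only [jetP, symDeriv_coe hu, symDeriv_coe hw] using this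
  have hg'' : ContDiffAt ℝ ∞ g' (f' x) := h0 ▸ hg'
  funext k
  apply Subtype.ext
  have c : ContDiffAt ℝ ∞ (fun y => g (f y)) x := hg.comp x hf
  have c' : ContDiffAt ℝ ∞ (fun y => g' (f' y)) x := hg''.comp x hf'
  simp only [jetP]
  rw [symDeriv_coe c, symDeriv_coe c']
  have e1 := iteratedFDeriv_comp hg hf (i := k + 1) (by exact_mod_cast le_top)
  have e2 := iteratedFDeriv_comp hg'' hf' (i := k + 1) (by exact_mod_cast le_top)
  simp only [Function.comp_def] at e1 e2
  rw [e1, e2, h0]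
  refine Finset.sum_congr rfl fun c _ => ?_
  have hk : (k : ℕ) + 1 ≤ q := k.2
  have hl : ftaylorSeries ℝ g' (f x) c.length = ftaylorSeries ℝ g (f x) c.length :=
    key hg' hg hgg _ (c.length_pos (by omega)) (c.length_le.trans hk)
  have hp : (fun m => ftaylorSeries ℝ f' x (c.partSize m)) =
      fun m => ftaylorSeries ℝ f x (c.partSize m) :=
    funext fun m => key hf' hf hff _ (c.partSize_pos m) ((c.partSize_le m).trans hk)
  simp only [FormalMultilinearSeries.compAlongOrderedFinpartition, hl, hp]

/-- The average of a multilinear map over the permutations of its arguments. -/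
def symmetrizeAux (k : ℕ) : ContinuousMultilinearMap ℝ (fun _ : Fin k => E) E →L[ℝ]
    ContinuousMultilinearMap ℝ (fun _ : Fin k => E) E :=
  (k.factorial : ℝ)⁻¹ • ∑ σ : Equiv.Perm (Fin k),
    ((ContinuousMultilinearMap.domDomCongrₗᵢ ℝ E E σ).toContinuousLinearEquiv :
      ContinuousMultilinearMap ℝ (fun _ : Fin k => E) E →L[ℝ] _)

theorem symmetrizeAux_apply {k : ℕ} (p : ContinuousMultilinearMap ℝ (fun _ : Fin k => E) E)
    (v : Fin k → E) :
    symmetrizeAux k p v = (k.factorial : ℝ)⁻¹ • ∑ σ : Equiv.Perm (Fin k), p (v ∘ σ) := by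
  simp only [symmetrizeAux, smul_apply, sum_apply]
  rfl

/-- Symmetrization, a continuous projection onto the symmetric multilinear maps. Composing with it
turns `symDeriv`, whose values are defined by cases, into a smooth function of the point. -/
def symmetrize (k : ℕ) : ContinuousMultilinearMap ℝ (fun _ : Fin k => E) E →L[ℝ] SymMap E k :=
  (symmetrizeAux k).codRestrict (SymMap E k) (by
    intro p τ v
    rw [symmetrizeAux_apply, symmetrizeAux_apply]
    congr 1
    exact Fintype.sum_equiv (Equiv.mulLeft τ) _ _ fun σ => rfl)

theorem symmetrize_coe {k : ℕ} (p : SymMap E k) : symmetrize k (p : ContinuousMultilinearMap ℝ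
    (fun _ : Fin k => E) E) = p := by
  apply Subtype.ext
  ext v
  have h : ∀ σ : Equiv.Perm (Fin k), p.1 (v ∘ σ) = p.1 v := fun σ => p.2 σ v
  change symmetrizeAux k p.1 v = p.1 v
  rw [symmetrizeAux_apply]
  simp only [h, Finset.sum_const, Finset.card_univ, Fintype.card_perm, Fintype.card_fin]
  rw [← Nat.cast_smul_eq_nsmul ℝ, smul_smul, inv_mul_cancel₀ (by positivity), one_smul]

theorem symDeriv_eq_symmetrize {f : E → E} {x : E} (h : ContDiffAt ℝ ∞ f x) (k : ℕ) :
    symDeriv k f x = symmetrize k (iteratedFDeriv ℝ k f x) := by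
  rw [← symDeriv_coe h, symmetrize_coe]

theorem SmoothNear.contDiffAt_symDeriv {f : E → E} {x : E} (h : SmoothNear f x) (k : ℕ) :
    ContDiffAt ℝ ∞ (symDeriv k f) x := by
  have h1 : ContDiffAt ℝ ∞ (fun y => symmetrize k (iteratedFDeriv ℝ k f y)) x :=
    (symmetrize (E := E) k).contDiff.contDiffAt.fun_comp x
      (h.contDiffAt.iteratedFDeriv_right (m := ∞) (i := k) (by exact_mod_cast le_top))
  refine h1.congr_of_eventuallyEq ?_
  filter_upwards [h] with y hy using symDeriv_eq_symmetrize hy k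

theorem SmoothNear.contDiffAt_jetP {f : E → E} {x : E} (h : SmoothNear f x) (q : ℕ) :
    ContDiffAt ℝ ∞ (jetP q f) x :=
  contDiffAt_pi.2 fun _ => h.contDiffAt_symDeriv _

theorem regular_iff {f : E → E} {x : E} (h : ContDiffAt ℝ ∞ f x) {q : ℕ} (hq : 0 < q) :
    jetP q f x ∈ regular E q ↔ Function.Bijective (fderiv ℝ f x) := by
  have : (fun v : E => (jetP q f x ⟨0, hq⟩ :
      ContinuousMultilinearMap ℝ (fun _ : Fin (0 + 1) => E) E) (fun _ => v)) = fderiv ℝ f x := by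
    funext v
    simp only [jetP, symDeriv_coe h]
    exact iteratedFDeriv_one_apply _
  rw [← this]
  exact ⟨fun h => h hq, fun h _ => h⟩

theorem symDeriv_zero_apply {f : E → E} {x : E} (h : ContDiffAt ℝ ∞ f x) (v) :
    (symDeriv 0 f x).1 v = f x := by
  rw [symDeriv_coe h]; simp

theorem fderiv_apply_of_symDeriv_one {f : E → E} {x : E} (h : ContDiffAt ℝ ∞ f x) (v : E) :
    (symDeriv 1 f x).1 (fun _ => v) = fderiv ℝ f x v := by
  rw [symDeriv_coe h]; exact iteratedFDeriv_one_apply _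

theorem fderiv_eq_of_jetP_eq {f g : E → E} {x y : E} (hf : ContDiffAt ℝ ∞ f x)
    (hg : ContDiffAt ℝ ∞ g y) {q : ℕ} (hq : 0 < q) (e : jetP q f x = jetP q g y) :
    fderiv ℝ f x = fderiv ℝ g y := by
  ext v
  rw [← fderiv_apply_of_symDeriv_one hf, ← fderiv_apply_of_symDeriv_one hg]
  have := congrFun e ⟨0, hq⟩
  simp only [jetP] at this
  rw [this]

theorem symDeriv_id_of_two_le (k : ℕ) (x : E) : symDeriv (k + 2) (fun y : E => y) x = 0 := by
  apply Subtype.ext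
  rw [symDeriv_coe contDiff_fun_id.contDiffAt]
  ext v
  rw [iteratedFDeriv_succ_apply_right]
  simp [fderiv_fun_id, iteratedFDeriv_const_of_ne]

theorem jetP_id (q : ℕ) (x : E) : jetP q (fun y : E => y) x = idJet E q := by
  funext k
  apply Subtype.ext
  simp only [jetP, idJet]
  rw [symDeriv_coe contDiff_fun_id.contDiffAt, symDeriv_coe contDiff_fun_id.contDiffAt]
  obtain ⟨k, hk⟩ := k
  ext v
  simp only [iteratedFDeriv_succ_apply_right, fderiv_fun_id]
  cases k with
  | zero => simp
  | succ k => simp [iteratedFDeriv_const_of_ne]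

theorem idJet_mem_regular (q : ℕ) : idJet E q ∈ regular E q := by
  intro hq
  exact (regular_iff (f := fun y : E => y) (x := 0) contDiffAt_id hq).2
    (by simpa [fderiv_fun_id] using Function.bijective_id) hq

end Jets

/-! ### Taylor polynomials and existence of local diffeomorphisms with given jets -/

section Taylor

variable {E : Type*} [NormedAddCommGroup E] [NormedSpace ℝ E]

theorem contDiff_taylor {q : ℕ} (ξ : Jet E q) (x : E) : ContDiff ℝ ∞ (taylor ξ x) := by
  unfold taylor
  refine ContDiff.sum fun k _ => ContDiff.const_smul _ ?_
  exact (ξ k).1.contDiff.comp (contDiff_pi.2 fun _ => contDiff_id.sub contDiff_const)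

theorem symDeriv_taylor [FiniteDimensional ℝ E] {q : ℕ} (ξ : Jet E q) (x : E) (k : Fin (q + 1)) :
    symDeriv (k : ℕ) (taylor ξ x) x = ξ k := by
  have : CompleteSpace E := FiniteDimensional.complete ℝ E
  apply Subtype.ext
  rw [symDeriv_coe (contDiff_taylor ξ x).contDiffAt]
  -- the Taylor polynomial as a formal power series
  let p : FormalMultilinearSeries ℝ E E := fun n =>
    if h : n < q + 1 then ((n.factorial : ℝ)⁻¹) • (ξ ⟨n, h⟩).1 else 0
  have hp : ∀ j : Fin (q + 1), p j = (((j : ℕ).factorial : ℝ)⁻¹) • (ξ j).1 := fun j => by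
    simp only [p, j.2, dif_pos, Fin.eta]
  have h0 : HasFiniteFPowerSeriesOnBall p.sum p 0 (q + 1) ⊤ :=
    p.hasFiniteFPowerSeriesOnBall_of_finite fun m hm => by
      simp only [p, not_lt.2 hm, dif_neg, not_false_eq_true]
  have h1 := h0.comp_sub x
  rw [zero_add] at h1
  have h2 : (fun z => p.sum (z - x)) = taylor ξ x := by
    funext z
    have := h0.eq_partialSum (z - x) (by simp) (q + 1) le_rfl
    rw [zero_add] at this
    rw [this, FormalMultilinearSeries.partialSum, taylor, Finset.sum_range]
    refine Finset.sum_congr rfl fun j _ => ?_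
    rw [hp j]; rfl
  rw [h2] at h1
  ext v
  rw [h1.toHasFPowerSeriesOnBall.iteratedFDeriv_eq_sum_of_completeSpace, hp k]
  have h : ∀ σ : Equiv.Perm (Fin (k : ℕ)), (ξ k).1 (fun i => v (σ i)) = (ξ k).1 v :=
    fun σ => (ξ k).2 σ v
  simp only [smul_apply, h, Finset.sum_const, Finset.card_univ,
    Fintype.card_perm, Fintype.card_fin]
  rw [← Nat.cast_smul_eq_nsmul ℝ, smul_smul, mul_inv_cancel₀ (by positivity), one_smul]

theorem jetP_taylor [FiniteDimensional ℝ E] {q : ℕ} (ξ : Jet E q) (x : E) :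
    jetP q (taylor ξ x) x = Jet.high ξ :=
  funext fun k => symDeriv_taylor ξ x k.succ

theorem taylor_self [FiniteDimensional ℝ E] {q : ℕ} (ξ : Jet E q) (x : E) :
    taylor ξ x x = Jet.low ξ := by
  rw [← symDeriv_zero_apply (contDiff_taylor ξ x).contDiffAt (fun _ => 0)]
  rw [show symDeriv 0 (taylor ξ x) x = ξ 0 from symDeriv_taylor ξ x 0]
  rfl

theorem exists_contDiff_jetP_eq [FiniteDimensional ℝ E] {q : ℕ} (b : JetP E q) (x y : E) :
    ∃ f : E → E, ContDiff ℝ ∞ f ∧ f x = y ∧ jetP q f x = b := by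
  let ξ : Jet E q := Fin.cons (SymMap.const y) b
  refine ⟨taylor ξ x, contDiff_taylor ξ x, ?_, jetP_taylor ξ x⟩
  rw [taylor_self]; rfl

/-- `f` restricts to a local diffeomorphism at `x`. Unlike `IsLocDiff` this speaks of a bare map,
which is convenient for composites and for families of maps. -/
def IsLocDiffAt (f : E → E) (x : E) : Prop :=
  SmoothNear f x ∧ Function.Bijective (fderiv ℝ f x)

theorem IsLocDiffAt.smoothNear {f : E → E} {x : E} (h : IsLocDiffAt f x) : SmoothNear f x := h.1

theorem IsLocDiffAt.contDiffAt {f : E → E} {x : E} (h : IsLocDiffAt f x) :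
    ContDiffAt ℝ ∞ f x := h.1.contDiffAt

theorem IsLocDiffAt.comp {g f : E → E} {x : E} (hg : IsLocDiffAt g (f x))
    (hf : IsLocDiffAt f x) : IsLocDiffAt (fun y => g (f y)) x := by
  refine ⟨hg.1.comp hf.1, ?_⟩
  rw [fderiv_fun_comp x hg.1.differentiableAt hf.1.differentiableAt]
  exact hg.2.comp hf.2

theorem IsLocDiff.fderiv_symm_apply {f : OpenPartialHomeomorph E E} (h : IsLocDiff f) {x : E}
    (hx : x ∈ f.source) (v : E) : fderiv ℝ f.symm (f x) (fderiv ℝ f x v) = v := by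
  have h1 : DifferentiableAt ℝ f.symm (f x) :=
    (h.symm.smoothNear (f.map_source hx)).differentiableAt
  have h2 := fderiv_fun_comp x h1 (h.smoothNear hx).differentiableAt
  have h3 : (fun y => f.symm (f y)) =ᶠ[𝓝 x] fun y => y := f.eventually_left_inverse hx
  rw [h3.fderiv_eq, fderiv_fun_id] at h2
  exact (DFunLike.congr_fun h2 v).symm

theorem IsLocDiff.fderiv_apply_symm {f : OpenPartialHomeomorph E E} (h : IsLocDiff f) {x : E}
    (hx : x ∈ f.source) (v : E) : fderiv ℝ f x (fderiv ℝ f.symm (f x) v) = v := by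
  have := h.symm.fderiv_symm_apply (f.map_source hx) v
  rwa [OpenPartialHomeomorph.symm_symm, f.left_inv hx] at this

theorem IsLocDiff.isLocDiffAt {f : OpenPartialHomeomorph E E} (h : IsLocDiff f) {x : E}
    (hx : x ∈ f.source) : IsLocDiffAt f x :=
  ⟨h.smoothNear hx, Function.bijective_iff_has_inverse.2
    ⟨fderiv ℝ f.symm (f x), h.fderiv_symm_apply hx, h.fderiv_apply_symm hx⟩⟩

theorem isOpen_bijective [FiniteDimensional ℝ E] :
    IsOpen {A : E →L[ℝ] E | Function.Bijective A} := by
  have e : {A : E →L[ℝ] E | Function.Bijective A} =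
      Set.range ((↑) : (E ≃L[ℝ] E) → E →L[ℝ] E) := by
    ext A
    constructor
    · intro h
      exact ⟨(LinearEquiv.ofBijective (A : E →ₗ[ℝ] E) h).toContinuousLinearEquiv, by ext; rfl⟩
    · rintro ⟨A, rfl⟩
      exact A.bijective
  have : CompleteSpace E := FiniteDimensional.complete ℝ E
  rw [e]
  exact ContinuousLinearEquiv.isOpen

theorem IsLocDiffAt.eventually [FiniteDimensional ℝ E] {f : E → E} {x : E}
    (h : IsLocDiffAt f x) : ∀ᶠ y in 𝓝 x, IsLocDiffAt f y := by
  have h1 : ContinuousAt (fderiv ℝ f) x :=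
    (h.contDiffAt.fderiv_right (m := 0) (by simp)).continuousAt
  filter_upwards [h.1.eventually, h1.eventually (isOpen_bijective.mem_nhds h.2)] with y h2 h3
  exact ⟨h2, h3⟩

theorem IsLocDiffAt.exists_openPartialHomeomorph [FiniteDimensional ℝ E] {f : E → E} {x : E}
    (h : IsLocDiffAt f x) : ∃ g : OpenPartialHomeomorph E E,
      IsLocDiff g ∧ x ∈ g.source ∧ ∀ y, g y = f y := by
  have : CompleteSpace E := FiniteDimensional.complete ℝ E
  have hder : ∀ y, IsLocDiffAt f y → ∃ A : E ≃L[ℝ] E, HasFDerivAt f (A : E →L[ℝ] E) y := by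
    intro y hy
    refine ⟨(LinearEquiv.ofBijective (fderiv ℝ f y : E →ₗ[ℝ] E) hy.2).toContinuousLinearEquiv, ?_⟩
    exact hy.1.differentiableAt.hasFDerivAt
  obtain ⟨A, hA⟩ := hder x h
  obtain ⟨U, hU, hUo, hxU⟩ := eventually_nhds_iff.1 h.eventually
  let g₀ := h.contDiffAt.toOpenPartialHomeomorph f hA (by simp)
  let g := g₀.restrOpen U hUo
  have hgs : g.source ⊆ U := fun y hy => by
    rw [OpenPartialHomeomorph.restrOpen_source] at hy; exact hy.2
  refine ⟨g, ⟨fun y hy => (hU y (hgs hy)).contDiffAt.contDiffWithinAt, fun y hy => ?_⟩, ?_,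
    fun y => rfl⟩
  · obtain ⟨B, hB⟩ := hder (g.symm y) (hU _ (hgs (g.map_target hy)))
    exact (g.contDiffAt_symm hy hB
      (hU _ (hgs (g.map_target hy))).contDiffAt).contDiffWithinAt
  · rw [OpenPartialHomeomorph.restrOpen_source]
    exact ⟨h.contDiffAt.mem_toOpenPartialHomeomorph_source hA (by simp), hxU⟩

/-- Every invertible jet is the jet of a local diffeomorphism. -/
theorem exists_isLocDiff_jetP_eq [FiniteDimensional ℝ E] {q : ℕ} (hq : 0 < q) {b : JetP E q}
    (hb : b ∈ regular E q) (x y : E) : ∃ f : OpenPartialHomeomorph E E,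
      IsLocDiff f ∧ x ∈ f.source ∧ f x = y ∧ jetP q f x = b := by
  obtain ⟨f, hf, rfl, rfl⟩ := exists_contDiff_jetP_eq b x y
  obtain ⟨g, hg, hx, e⟩ := IsLocDiffAt.exists_openPartialHomeomorph
    ⟨hf.smoothNear x, (regular_iff hf.contDiffAt hq).1 hb⟩
  have e' : (g : E → E) = f := funext e
  exact ⟨g, hg, hx, e x, by rw [e']⟩

theorem IsLocDiffAt.jetP_mem_regular {f : E → E} {x : E} (h : IsLocDiffAt f x) {q : ℕ}
    (hq : 0 < q) : jetP q f x ∈ regular E q := (regular_iff h.contDiffAt hq).2 h.2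

/-- The derivative of `f_μ` in the direction `v` is `f_{μ + 1_i} v^i`. -/
theorem hasFDerivAt_symDeriv [FiniteDimensional ℝ E] {f : E → E} {x : E} (h : SmoothNear f x)
    (k : ℕ) : HasFDerivAt (symDeriv k f)
      (LinearMap.toContinuousLinearMap (SymMap.contract k (symDeriv (k + 1) f x))) x := by
  have hd := ((h.contDiffAt_symDeriv k).differentiableAt (by simp)).hasFDerivAt
  refine hd.congr_fderiv ?_
  symm
  ext1 v
  apply Subtype.ext
  have h1 := (SymMap E k).subtypeL.hasFDerivAt.comp x hd
  have h2 : (fun y => iteratedFDeriv ℝ k f y) =ᶠ[𝓝 x]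
      fun y => (SymMap E k).subtypeL (symDeriv k f y) := by
    filter_upwards [h] with y hy using (symDeriv_coe hy k).symm
  have h3 := (h1.congr_of_eventuallyEq h2).fderiv
  have h4 := DFunLike.congr_fun h3 v
  change _ = (SymMap E k).subtypeL (fderiv ℝ (symDeriv k f) x v)
  refine Eq.trans ?_ h4
  ext w
  change (symDeriv (k + 1) f x).1 (Fin.cons v w) = _
  rw [symDeriv_coe h.contDiffAt]
  rfl

/-- Where `f` has the `q`-jet of the identity, all derivatives of `f` of orders `2, …, q` vanish, so
that the derivative of `w ↦ j_q(f)(w)` is `δ` of the derivative of order `q + 1`. -/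
theorem hasFDerivAt_jetP_of_jetP_eq_idJet [FiniteDimensional ℝ E] {f : E → E} {x : E}
    (h : SmoothNear f x) {q : ℕ} (e : jetP q f x = idJet E q) :
    HasFDerivAt (jetP q f) (LinearMap.toContinuousLinearMap
      (Jet.high ∘ₗ (delta q (symDeriv (q + 1) f x) : E →ₗ[ℝ] Jet E q))) x := by
  rw [hasFDerivAt_pi']
  intro k
  refine (hasFDerivAt_symDeriv h ((k : ℕ) + 1)).congr_fderiv ?_
  symm
  ext1 v
  obtain ⟨k, hk⟩ := k
  rcases eq_or_ne (k + 1) q with rfl | hne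
  · change (Pi.single (M := fun k : Fin (k + 1 + 1) => SymMap E (k : ℕ)) (Fin.last (k + 1))
      (SymMap.contract (k + 1) (symDeriv (k + 1 + 1) f x) v)) (Fin.last (k + 1)) = _
    rw [Pi.single_eq_same]
    rfl
  · have h1 : symDeriv (k + 2) f x = 0 := by
      have := congrFun e ⟨k + 1, by omega⟩
      simp only [jetP] at this
      rw [this]
      exact symDeriv_id_of_two_le _ _
    change (Pi.single (M := fun k : Fin (q + 1) => SymMap E (k : ℕ)) (Fin.last q)
      (SymMap.contract q (symDeriv (q + 1) f x) v)) ⟨k + 1, _⟩ =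
      SymMap.contract (k + 1) (symDeriv (k + 2) f x) v
    rw [Pi.single_eq_of_ne (by simpa [Fin.ext_iff] using hne), h1]
    rfl

theorem low_delta [FiniteDimensional ℝ E] {q : ℕ} (hq : 0 < q) (ζ : SymMap E (q + 1)) (v : E) :
    (delta q ζ v).low = 0 := by
  change ((Pi.single (M := fun k : Fin (q + 1) => SymMap E (k : ℕ)) (Fin.last q)
      (SymMap.contract q ζ v)) 0).1 _ = 0
  rw [Pi.single_eq_of_ne (by simp [Fin.ext_iff]; omega)]
  rfl

/-- A local diffeomorphism fixing `x`, with `q`-jet that of the identity and prescribed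
derivative of order `q + 1`. -/
theorem exists_isLocDiff_symDeriv_eq [FiniteDimensional ℝ E] {q : ℕ} (hq : 0 < q)
    (ζ : SymMap E (q + 1)) (x : E) : ∃ h : OpenPartialHomeomorph E E,
      IsLocDiff h ∧ x ∈ h.source ∧ h x = x ∧ jetP q h x = idJet E q ∧
      symDeriv (q + 1) h x = ζ := by
  let b : JetP E (q + 1) := Fin.snoc (α := fun k : Fin (q + 1) => SymMap E ((k : ℕ) + 1))
    (idJet E q) ζ
  have hb0 : ∀ k : Fin q, b k.castSucc = idJet E q k := fun k => Fin.snoc_castSucc _ _ _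
  have hbl : b (Fin.last q) = ζ := Fin.snoc_last _ _
  have hb : b ∈ regular E (q + 1) := by
    intro h0
    have := hb0 ⟨0, hq⟩
    change b ⟨0, h0⟩ = _ at this
    rw [this]
    exact idJet_mem_regular q hq
  obtain ⟨h, h1, h2, h3, h4⟩ := exists_isLocDiff_jetP_eq (Nat.succ_pos q) hb x x
  refine ⟨h, h1, h2, h3, ?_, ?_⟩
  · funext k
    rw [← hb0 k, ← h4]; rfl
  · rw [← hbl, ← h4]; rfl

end Taylor

/-! ### Jets of families of maps -/

section Families

variable {E : Type*} [NormedAddCommGroup E] [NormedSpace ℝ E]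

/-- For a smooth function of a parameter and a space variable, the partial derivatives in the two
commute. The map `Φ` stands for the currying isomorphism by which `iteratedFDeriv` is defined. -/
theorem fderiv_partial_family {W W' : Type*} [NormedAddCommGroup W] [NormedSpace ℝ W]
    [NormedAddCommGroup W'] [NormedSpace ℝ W'] (Φ : (E →L[ℝ] W) →L[ℝ] W') {U : Set (ℝ × E)}
    (hU : IsOpen U) {G H : ℝ × E → W} (hG : ContDiffOn ℝ ∞ G U)
    (hH : ∀ p ∈ U, fderiv ℝ G p (1, 0) = H p) :
    ContDiffOn ℝ ∞ (fun p : ℝ × E => Φ (fderiv ℝ (fun y => G (p.1, y)) p.2)) U ∧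
    ∀ p ∈ U, fderiv ℝ (fun p : ℝ × E => Φ (fderiv ℝ (fun y => G (p.1, y)) p.2)) p (1, 0) =
      Φ (fderiv ℝ (fun y => H (p.1, y)) p.2) := by
  let R : (ℝ × E →L[ℝ] W) →L[ℝ] (E →L[ℝ] W) :=
    (ContinuousLinearMap.compL ℝ E (ℝ × E) W).flip (ContinuousLinearMap.inr ℝ ℝ E)
  have hR : ∀ (g : ℝ × E → W) (p), DifferentiableAt ℝ g p →
      fderiv ℝ (fun y => g (p.1, y)) p.2 = R (fderiv ℝ g p) := fun g p h =>
    (HasFDerivAt.comp p.2 (f := fun y => (p.1, y)) h.hasFDerivAt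
      (hasFDerivAt_prodMk_right p.1 p.2)).fderiv
  have hGd : ∀ p ∈ U, ContDiffAt ℝ ∞ G p := fun p hp => hG.contDiffAt (hU.mem_nhds hp)
  have hsm : ∀ p ∈ U, ContDiffAt ℝ ∞ (fderiv ℝ G) p := fun p hp =>
    (hGd p hp).fderiv_right (m := ∞) (by simp)
  have heq : ∀ p ∈ U, (fun p : ℝ × E => Φ (fderiv ℝ (fun y => G (p.1, y)) p.2)) =ᶠ[𝓝 p]
      fun p => Φ (R (fderiv ℝ G p)) := by
    intro p hp
    filter_upwards [hU.mem_nhds hp] with p' hp'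
    rw [hR G p' ((hGd p' hp').differentiableAt (by simp))]
  constructor
  · intro p hp
    have h1 : ContDiffAt ℝ ∞ (fun p => Φ (R (fderiv ℝ G p))) p :=
      Φ.contDiff.contDiffAt.fun_comp p (R.contDiff.contDiffAt.fun_comp p (hsm p hp))
    exact (h1.congr_of_eventuallyEq (heq p hp)).contDiffWithinAt
  · intro p hp
    have hd2 := ((hsm p hp).differentiableAt (by simp)).hasFDerivAt
    have h2 := (Φ.hasFDerivAt.comp p (R.hasFDerivAt.comp p hd2)).fderiv
    have h3 := DFunLike.congr_fun h2 (1, 0)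
    rw [(heq p hp).fderiv_eq]
    refine h3.trans ?_
    change Φ (R (fderiv ℝ (fderiv ℝ G) p (1, 0))) = _
    congr 1
    -- symmetry of the second derivative of `G`
    have hsym : IsSymmSndFDerivAt ℝ G p := 
      ((hGd p hp).of_le (m := 2) ENat.LEInfty.out).isSymmSndFDerivAt (by simp)
    have h4 : (fun y => H (p.1, y)) =ᶠ[𝓝 p.2] fun y => fderiv ℝ G (p.1, y) (1, 0) := by
      have : ContinuousAt (fun y : E => (p.1, y)) p.2 := by fun_prop
      filter_upwards [this.eventually (hU.mem_nhds hp)] with y hy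
      exact (hH (p.1, y) hy).symm
    have hd3 := hd2.clm_apply (hasFDerivAt_const ((1 : ℝ), (0 : E)) p)
    rw [h4.fderiv_eq, hR (fun q => fderiv ℝ G q (1, 0)) p hd3.differentiableAt, hd3.fderiv]
    ext1 v
    change fderiv ℝ (fderiv ℝ G) p (1, 0) (0, v) = _
    rw [hsym.eq]
    simp [R]

/-- In a smooth family of maps the derivatives in the space variable depend smoothly on both
variables, and commute with the derivative in the parameter. -/
theorem iteratedFDeriv_family {F : ℝ × E → E} {U : Set (ℝ × E)} (hU : IsOpen U)
    (hF : ContDiffOn ℝ ∞ F U) (k : ℕ) :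
    ContDiffOn ℝ ∞ (fun p : ℝ × E => iteratedFDeriv ℝ k (fun y => F (p.1, y)) p.2) U ∧
    ∀ p ∈ U, fderiv ℝ (fun p : ℝ × E => iteratedFDeriv ℝ k (fun y => F (p.1, y)) p.2) p (1, 0) =
      iteratedFDeriv ℝ k (fun y => fderiv ℝ F (p.1, y) (1, 0)) p.2 := by
  induction k with
  | zero =>
    let Φ : E →L[ℝ] ContinuousMultilinearMap ℝ (fun _ : Fin 0 => E) E :=
      (continuousMultilinearCurryFin0 ℝ E E).symm.toContinuousLinearEquiv.toContinuousLinearMap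
    refine ⟨Φ.contDiff.comp_contDiffOn hF, fun p hp => ?_⟩
    have h1 := ((hF.contDiffAt (hU.mem_nhds hp)).differentiableAt (by simp)).hasFDerivAt
    have h2 := (Φ.hasFDerivAt.comp p h1).fderiv
    exact DFunLike.congr_fun h2 (1, 0)
  | succ k ih =>
    exact fderiv_partial_family ((continuousMultilinearCurryLeftEquiv ℝ (fun _ : Fin (k + 1) =>
        E) E).symm.toContinuousLinearEquiv.toContinuousLinearMap) hU ih.1 ih.2

theorem hasDerivAt_symDeriv_family {F : ℝ × E → E} {U : Set (ℝ × E)} (hU : IsOpen U)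
    (hF : ContDiffOn ℝ ∞ F U) {t : ℝ} {x : E} (hx : (t, x) ∈ U) (k : ℕ) :
    HasDerivAt (fun s => symDeriv k (fun y => F (s, y)) x)
      (symDeriv k (fun y => fderiv ℝ F (t, y) (1, 0)) x) t := by
  obtain ⟨h1, h2⟩ := iteratedFDeriv_family hU hF k
  have hd := ((h1.contDiffAt (hU.mem_nhds hx)).differentiableAt (by simp)).hasFDerivAt
  have h3 : HasFDerivAt (fun s : ℝ => (s, x)) (ContinuousLinearMap.inl ℝ ℝ E) t :=
    hasFDerivAt_prodMk_left t x
  have h4 := ((symmetrize k).hasFDerivAt.comp t (HasFDerivAt.comp t (f := fun s : ℝ => (s, x))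
    hd h3)).hasDerivAt
  have hc : ContDiffAt ℝ ∞ (fun y => fderiv ℝ F (t, y) (1, 0)) x := by
    have h5 : ContDiffAt ℝ ∞ (fderiv ℝ F) (t, x) :=
      (hF.contDiffAt (hU.mem_nhds hx)).fderiv_right (m := ∞) (by simp)
    have h6 : ContDiffAt ℝ ∞ (fun y => fderiv ℝ F (t, y)) x :=
      h5.comp x (contDiff_prodMk_right t).contDiffAt
    exact h6.clm_apply contDiffAt_const
  have h7 := h2 (t, x) hx
  refine HasDerivAt.congr_of_eventuallyEq (h4.congr_deriv ?_) ?_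
  · rw [symDeriv_eq_symmetrize hc, ← h7]
    simp
  · have : ContinuousAt (fun s : ℝ => (s, x)) t := by fun_prop
    filter_upwards [this.eventually (hU.mem_nhds hx)] with s hs
    refine symDeriv_eq_symmetrize ?_ k
    exact (hF.contDiffAt (hU.mem_nhds hs)).comp x (contDiff_prodMk_right s).contDiffAt

theorem hasDerivAt_jetP_family {F : ℝ × E → E} {t : ℝ} {x : E}
    (hF : ∀ᶠ p in 𝓝 (t, x), ContDiffAt ℝ ∞ F p) (q : ℕ) :
    HasDerivAt (fun s => jetP q (fun y => F (s, y)) x)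
      (jetP q (fun y => fderiv ℝ F (t, y) (1, 0)) x) t := by
  obtain ⟨U, hU, hUo, hx⟩ := eventually_nhds_iff.1 hF
  exact hasDerivAt_pi.2 fun _ => hasDerivAt_symDeriv_family hUo
    (fun p hp => (hU p hp).contDiffWithinAt) hx _

end Families

/-! ### Finite dimensionality of the jet spaces -/

section Finite

variable {E : Type*} [NormedAddCommGroup E] [NormedSpace ℝ E] [FiniteDimensional ℝ E]

instance (k : ℕ) : FiniteDimensional ℝ (SymMap E k) :=
  let f : SymMap E k →ₗ[ℝ] MultilinearMap ℝ (fun _ : Fin k => E) E :=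
    ContinuousMultilinearMap.toMultilinearMapLinear ∘ₗ (SymMap E k).subtype
  FiniteDimensional.of_injective f
    (ContinuousMultilinearMap.toMultilinearMap_injective.comp Subtype.val_injective)

instance (q : ℕ) : FiniteDimensional ℝ (Jet E q) := Module.Finite.pi

instance (q : ℕ) : FiniteDimensional ℝ (JetP E q) := Module.Finite.pi

theorem isOpen_regular (q : ℕ) : IsOpen (regular E q) := by
  rcases Nat.eq_zero_or_pos q with rfl | hq
  · convert isOpen_univ
    ext a
    simp [regular]
  -- the linear part of a jet
  let lin : JetP E q →ₗ[ℝ] (E →L[ℝ] E) :=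
    { toFun := fun a => (continuousMultilinearCurryFin1 ℝ E E) (a ⟨0, hq⟩).1
      map_add' := fun _ _ => rfl
      map_smul' := fun _ _ => rfl }
  have hc : Continuous lin := lin.continuous_of_finiteDimensional
  convert isOpen_bijective.preimage hc
  ext a
  have : ∀ v, lin a v = (a ⟨0, hq⟩).1 (fun _ => v) := fun v => by
    change (a ⟨0, hq⟩).1 (Fin.snoc 0 v) = _
    refine congrArg _ (funext fun i => ?_)
    fin_cases i; rfl
  simp only [Set.mem_preimage, Set.mem_ofPred_eq]
  rw [show (lin a : E → E) = _ from funext this]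
  exact ⟨fun h => h hq, fun h _ => h⟩

end Finite

/-! ### The action of jets on the typical fibre -/

section Action

variable {E : Type*} [NormedAddCommGroup E] [NormedSpace ℝ E]
  {EN : Type*} [NormedAddCommGroup EN] [NormedSpace ℝ EN]
  {N : Type*} [TopologicalSpace N] [ChartedSpace EN N]
  {P : Type*} [NormedAddCommGroup P] [NormedSpace ℝ P]

/-- The derivative of an `N`-valued map, with values in the model space `EN` instead of the
definitionally equal tangent space. Derivatives at points of `N` that are equal but not
definitionally so can then be compared and added. -/
def velocity (s : P → N) (p : P) : P →L[ℝ] EN := mfderiv 𝓘(ℝ, P) 𝓘(ℝ, EN) s p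

theorem velocity_congr {s s' : P → N} {p : P} (e : s =ᶠ[𝓝 p] s') :
    velocity (EN := EN) s p = velocity s' p := e.mfderiv_eq

theorem velocity_comp {Q : Type*} [NormedAddCommGroup Q] [NormedSpace ℝ Q] {s : P → N}
    {f : Q → P} {p : Q} (hs : MDifferentiableAt 𝓘(ℝ, P) 𝓘(ℝ, EN) s (f p))
    (hf : DifferentiableAt ℝ f p) :
    velocity (EN := EN) (fun w => s (f w)) p = (velocity s (f p)).comp (fderiv ℝ f p) := by
  have := mfderiv_comp p hs hf.mdifferentiableAt
  rw [mfderiv_eq_fderiv] at this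
  exact this

theorem velocity_const (u : N) (p : P) : velocity (EN := EN) (fun _ => u) p = 0 :=
  mfderiv_const

theorem oneJet_eq_iff {t t' : OneJet E (EN := EN) N} :
    t = t' ↔ t.1 = t'.1 ∧ (t.2 : E →L[ℝ] EN) = t'.2 := by
  constructor
  · rintro rfl; exact ⟨rfl, rfl⟩
  · obtain ⟨u, σ⟩ := t
    obtain ⟨u', σ'⟩ := t'
    rintro ⟨h1, h2⟩
    change u = u' at h1
    subst h1
    exact congrArg _ h2

theorem j1_eq_j1_iff {s s' : E → N} {z z' : E} : j1 (EN := EN) s z = j1 s' z' ↔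
    s z = s' z' ∧ velocity (EN := EN) s z = velocity s' z' := oneJet_eq_iff

theorem j1_congr {s s' : E → N} {z : E} (e : s =ᶠ[𝓝 z] s') : j1 (EN := EN) s z = j1 s' z :=
  j1_eq_j1_iff.2 ⟨e.self_of_nhds, velocity_congr e⟩

namespace NaturalLaw

variable {q : ℕ} (lam : NaturalLaw E (EN := EN) N q)

/-- The derivative of `λ(u, a)` in the jet `a`. -/
def dJet (a : JetP E q) (u : N) : JetP E q →L[ℝ] EN := velocity (fun b => lam.act b u) a

/-- The derivative of `λ(u, a)` in the point `u`. -/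
def dFib (a : JetP E q) (u : N) : EN →L[ℝ] EN := mfderiv 𝓘(ℝ, EN) 𝓘(ℝ, EN) (lam.act a) u

theorem dFib_idJet (u : N) : lam.dFib (idJet E q) u = ContinuousLinearMap.id ℝ EN := by
  have : lam.act (idJet E q) = id := funext lam.act_id
  rw [dFib, this, mfderiv_id]
  rfl

theorem act_comp_of_isLocDiffAt [FiniteDimensional ℝ E] {g f : E → E} {x : E}
    (hg : IsLocDiffAt g (f x)) (hf : IsLocDiffAt f x) (u : N) :
    lam.act (jetP q (fun y => g (f y)) x) u =
      lam.act (jetP q g (f x)) (lam.act (jetP q f x) u) := by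
  obtain ⟨f', hf', hx, ef⟩ := hf.exists_openPartialHomeomorph
  obtain ⟨g', hg', hx', eg⟩ := hg.exists_openPartialHomeomorph
  obtain rfl : (f' : E → E) = f := funext ef
  obtain rfl : (g' : E → E) = g := funext eg
  exact lam.act_comp g' f' x u hg' hf' hx hx'

theorem act_jetP_symm_act {f : OpenPartialHomeomorph E E} (hf : IsLocDiff f) {x : E}
    (hx : x ∈ f.source) (u : N) :
    lam.act (jetP q f.symm (f x)) (lam.act (jetP q f x) u) = u := by
  rw [← lam.act_comp f.symm f x u hf.symm hf hx (f.map_source hx),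
    jetP_congr (f.eventually_left_inverse hx), jetP_id, lam.act_id]

theorem act_act_jetP_symm {f : OpenPartialHomeomorph E E} (hf : IsLocDiff f) {x : E}
    (hx : x ∈ f.source) (u : N) :
    lam.act (jetP q f x) (lam.act (jetP q f.symm (f x)) u) = u := by
  have := lam.act_jetP_symm_act hf.symm (f.map_source hx) u
  rwa [OpenPartialHomeomorph.symm_symm, f.left_inv hx] at this

/-- `lam.pull f s` is the section that the change of coordinates `f` carries to `s`. -/
theorem act_pull {f : OpenPartialHomeomorph E E} (hf : IsLocDiff f) {x : E}
    (hx : x ∈ f.source) (s : E → N) : lam.act (jetP q f x) (lam.pull f s x) = s (f x) :=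
  lam.act_act_jetP_symm hf hx _

theorem pull_trans {f g : OpenPartialHomeomorph E E} (hf : IsLocDiff f) (hg : IsLocDiff g)
    {x : E} (hx : x ∈ f.source) (hx' : f x ∈ g.source) (s : E → N) :
    lam.pull (f.trans g) s x = lam.pull f (lam.pull g s) x := by
  have := lam.act_comp f.symm g.symm (g (f x)) (s (g (f x))) hf.symm hg.symm
    (g.map_source hx') (by rw [g.left_inv hx']; exact f.map_source hx)
  rw [g.left_inv hx'] at this
  exact this

variable [FiniteDimensional ℝ E]

theorem contMDiffAt_act {a : JetP E q} (ha : a ∈ regular E q) (u : N) :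
    ContMDiffAt (𝓘(ℝ, JetP E q).prod 𝓘(ℝ, EN)) 𝓘(ℝ, EN) ∞
      (fun p : JetP E q × N => lam.act p.1 p.2) (a, u) :=
  lam.smooth.contMDiffAt (((isOpen_regular q).prod isOpen_univ).mem_nhds ⟨ha, trivial⟩)

theorem mdifferentiableAt_act_of_jet {a : JetP E q} (ha : a ∈ regular E q) (u : N) :
    MDifferentiableAt 𝓘(ℝ, JetP E q) 𝓘(ℝ, EN) (fun b => lam.act b u) a :=
  ((lam.contMDiffAt_act ha u).mdifferentiableAt (by simp)).comp a
    (mdifferentiableAt_id.prodMk mdifferentiableAt_const)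

theorem mdifferentiableAt_act_of_point {a : JetP E q} (ha : a ∈ regular E q) (u : N) :
    MDifferentiableAt 𝓘(ℝ, EN) 𝓘(ℝ, EN) (lam.act a) u :=
  ((lam.contMDiffAt_act ha u).mdifferentiableAt (by simp)).comp u
    (mdifferentiableAt_const.prodMk mdifferentiableAt_id)

theorem mdifferentiableAt_act {α : P → JetP E q} {s : P → N} {p : P}
    (hα : DifferentiableAt ℝ α p) (ha : α p ∈ regular E q)
    (hs : MDifferentiableAt 𝓘(ℝ, P) 𝓘(ℝ, EN) s p) :
    MDifferentiableAt 𝓘(ℝ, P) 𝓘(ℝ, EN) (fun w => lam.act (α w) (s w)) p :=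
  MDifferentiableAt.comp (g := fun r : JetP E q × N => lam.act r.1 r.2) (f := fun w => (α w, s w)) p
    ((lam.contMDiffAt_act ha (s p)).mdifferentiableAt (by simp)) (hα.mdifferentiableAt.prodMk hs)

/-- The chain rule for `w ↦ λ(s(w), α(w))`. -/
theorem velocity_act {α : P → JetP E q} {α' : P →L[ℝ] JetP E q} {s : P → N} {p : P}
    (hα : HasFDerivAt α α' p) (ha : α p ∈ regular E q)
    (hs : MDifferentiableAt 𝓘(ℝ, P) 𝓘(ℝ, EN) s p) (v : P) :
    velocity (EN := EN) (fun w => lam.act (α w) (s w)) p v =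
      lam.dJet (α p) (s p) (α' v) + lam.dFib (α p) (s p) (velocity s p v) := by
  have h1 := (lam.contMDiffAt_act ha (s p)).mdifferentiableAt (by simp)
  have h2 : MDifferentiableAt 𝓘(ℝ, P) (𝓘(ℝ, JetP E q).prod 𝓘(ℝ, EN)) (fun w => (α w, s w)) p :=
    hα.differentiableAt.mdifferentiableAt.prodMk hs
  have h3 := mfderiv_comp (g := fun r : JetP E q × N => lam.act r.1 r.2)
    (f := fun w => (α w, s w)) p h1 h2
  have h4 := mfderiv_prodMk (f := α) (g := s) hα.differentiableAt.mdifferentiableAt hs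
  have h5 := DFunLike.congr_fun h3 v
  refine h5.trans ?_
  refine (mfderiv_prod_eq_add_apply h1).trans ?_
  rw [h4, mfderiv_eq_fderiv, hα.fderiv]
  rfl

theorem velocity_act_const {α : P → JetP E q} {α' : P →L[ℝ] JetP E q} {p : P}
    (hα : HasFDerivAt α α' p) (ha : α p ∈ regular E q) (u : N) (v : P) :
    velocity (EN := EN) (fun w => lam.act (α w) u) p v = lam.dJet (α p) u (α' v) := by
  rw [lam.velocity_act hα ha mdifferentiableAt_const, velocity_const]
  simp

theorem contMDiffAt_pull (hq : 0 < q) {f : OpenPartialHomeomorph E E} (hf : IsLocDiff f) {x : E}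
    (hx : x ∈ f.source) {s : E → N} (hs : ContMDiffAt 𝓘(ℝ, E) 𝓘(ℝ, EN) ∞ s (f x)) :
    ContMDiffAt 𝓘(ℝ, E) 𝓘(ℝ, EN) ∞ (lam.pull f s) x := by
  have hfx : ContDiffAt ℝ ∞ f x := (hf.smoothNear hx).contDiffAt
  have h1 : ContDiffAt ℝ ∞ (fun w => jetP q f.symm (f w)) x :=
    ((hf.symm.smoothNear (f.map_source hx)).contDiffAt_jetP q).fun_comp x hfx
  have h2 : ContMDiffAt 𝓘(ℝ, E) 𝓘(ℝ, EN) ∞ (fun w => s (f w)) x :=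
    hs.comp x hfx.contMDiffAt
  exact ContMDiffAt.comp (g := fun r : JetP E q × N => lam.act r.1 r.2)
    (f := fun w => (jetP q f.symm (f w), s (f w))) x
    (lam.contMDiffAt_act ((hf.symm.isLocDiffAt (f.map_source hx)).jetP_mem_regular hq) _)
    (h1.contMDiffAt.prodMk h2)

/-- The first jet of the inverse image by a local diffeomorphism having the same `q`-jet as the
identity: the derivatives of order `q + 1` enter through the symbol. -/
theorem velocity_pull_of_jetP_eq_idJet (hq : 0 < q) {h : OpenPartialHomeomorph E E}
    (hh : IsLocDiff h) {z : E} (hz : z ∈ h.source) (hfix : h z = z)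
    (hid : jetP q h z = idJet E q) {s : E → N}
    (hs : ContMDiffAt 𝓘(ℝ, E) 𝓘(ℝ, EN) ∞ s z) :
    lam.pull h s z = s z ∧ ∀ v, velocity (EN := EN) (lam.pull h s) z v =
      velocity s z v - lam.dJet (idJet E q) (s z) (delta q (symDeriv (q + 1) h z) v).high := by
  have h0 : lam.pull h s z = s z := by
    have := lam.act_pull hh hz s
    rwa [hid, lam.act_id, hfix] at this
  refine ⟨h0, fun v => ?_⟩
  have e : (fun w => lam.act (jetP q h w) (lam.pull h s w)) =ᶠ[𝓝 z] fun w => s (h w) := by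
    filter_upwards [h.open_source.mem_nhds hz] with w hw using lam.act_pull hh hw s
  have hs' : ContMDiffAt 𝓘(ℝ, E) 𝓘(ℝ, EN) ∞ s (h z) := by rwa [hfix]
  have h1 := lam.velocity_act (hasFDerivAt_jetP_of_jetP_eq_idJet (hh.smoothNear hz) hid)
    ((hh.isLocDiffAt hz).jetP_mem_regular hq)
    ((lam.contMDiffAt_pull hq hh hz hs').mdifferentiableAt (by simp)) v
  rw [velocity_congr e, velocity_comp (hs'.mdifferentiableAt (by simp))
    (hh.smoothNear hz).differentiableAt, hid, h0, dFib_idJet, hfix,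
    fderiv_eq_of_jetP_eq (hh.smoothNear hz).contDiffAt contDiff_fun_id.contDiffAt hq
      (hid.trans (jetP_id q z).symm), fderiv_fun_id] at h1
  simp only [ContinuousLinearMap.comp_id, ContinuousLinearMap.id_apply] at h1
  rw [h1]
  exact (add_sub_cancel_left _ _).symm

/-- The derivative of the relation `s'(g(w)) = λ(s(w), j_q(g)(w))`. -/
theorem velocity_apply_fderiv (hq : 0 < q) {g : OpenPartialHomeomorph E E} (hg : IsLocDiff g)
    {z : E} (hz : z ∈ g.source) {s s' : E → N} (hs : ContMDiffAt 𝓘(ℝ, E) 𝓘(ℝ, EN) ∞ s z)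
    (hs' : ContMDiffAt 𝓘(ℝ, E) 𝓘(ℝ, EN) ∞ s' (g z))
    (e : ∀ᶠ w in 𝓝 z, s' (g w) = lam.act (jetP q g w) (s w)) (v : E) :
    velocity (EN := EN) s' (g z) (fderiv ℝ g z v) =
      velocity (fun w => lam.act (jetP q g w) (s z)) z v +
        lam.dFib (jetP q g z) (s z) (velocity s z v) := by
  have hJ : HasFDerivAt (jetP q g) (fderiv ℝ (jetP q g) z) z :=
    (((hg.smoothNear hz).contDiffAt_jetP q).differentiableAt (by simp)).hasFDerivAt
  have hreg := (hg.isLocDiffAt hz).jetP_mem_regular hq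
  have h1 := lam.velocity_act hJ hreg (hs.mdifferentiableAt (by simp)) v
  rw [← lam.velocity_act_const hJ hreg, ← velocity_congr e,
    velocity_comp (hs'.mdifferentiableAt (by simp)) (hg.smoothNear hz).differentiableAt] at h1
  exact h1

/-- Equivariance of the symbol `ζ ↦ L^{τμ}_k ζ^k_{μ + 1_i}`, `|μ| = q`. A form `ζ` is the derivative
of order `q + 1` of a local diffeomorphism `h` with the `q`-jet of the identity; the conjugate
`h' = g ∘ h ∘ g⁻¹` has the `q`-jet of the identity as well, and `ζ'` is its derivative of order
`q + 1`. The identity is the derivative of the action of `h' ∘ g = g ∘ h`. -/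
theorem dFib_symbol (hq : 0 < q) {g : OpenPartialHomeomorph E E} (hg : IsLocDiff g) {z : E}
    (hz : z ∈ g.source) (u : N) (ζ : SymMap E (q + 1)) :
    ∃ ζ' : SymMap E (q + 1), ∀ v,
      lam.dJet (idJet E q) (lam.act (jetP q g z) u) (delta q ζ' (fderiv ℝ g z v)).high =
        lam.dFib (jetP q g z) u (lam.dJet (idJet E q) u (delta q ζ v).high) := by
  obtain ⟨h, hh, hzh, hfix, hid, rfl⟩ := exists_isLocDiff_symDeriv_eq hq ζ z
  have hg0 := hg.isLocDiffAt hz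
  have hgs : IsLocDiffAt g.symm (g z) := hg.symm.isLocDiffAt (g.map_source hz)
  have hh0 := hh.isLocDiffAt hzh
  -- the conjugate of `h` by `g`
  let h' : E → E := fun y => g (h (g.symm y))
  have hgl : g.symm (g z) = z := g.left_inv hz
  have hh1 : IsLocDiffAt (fun y => h (g.symm y)) (g z) := by
    refine IsLocDiffAt.comp ?_ hgs
    rwa [hgl]
  have hh' : IsLocDiffAt h' (g z) := by
    refine IsLocDiffAt.comp (f := fun y => h (g.symm y)) ?_ hh1
    rwa [hgl, hfix]
  have hid' : jetP q h' (g z) = idJet E q := by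
    have e1 : jetP q (fun y => h (g.symm y)) (g z) = jetP q (fun y => g.symm y) (g z) := by
      refine jetP_comp_congr (g := fun y => y) (f := g.symm) contDiff_fun_id.contDiffAt
        hgs.contDiffAt ?_ hgs.contDiffAt rfl rfl ?_
      · rw [hgl]; exact hh0.contDiffAt
      · rw [hgl, hid, jetP_id]
    have e2 : jetP q h' (g z) = jetP q (fun y => g (g.symm y)) (g z) := by
      have hg1 : ContDiffAt ℝ ∞ g (g.symm (g z)) := by rw [hgl]; exact hg0.contDiffAt
      refine jetP_comp_congr (g := g) (f := g.symm) hg1 hgs.contDiffAt hg1 hh1.contDiffAt ?_ e1 rfl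
      rw [hgl, hfix]
    rw [e2, jetP_congr (g.eventually_right_inverse (g.map_source hz)), jetP_id]
  refine ⟨symDeriv (q + 1) h' (g z), fun v => ?_⟩
  -- two ways of letting `g ∘ h = h' ∘ g` act
  have e : (fun w => lam.act (jetP q h' (g w)) (lam.act (jetP q g w) u)) =ᶠ[𝓝 z]
      fun w => lam.act (jetP q g (h w)) (lam.act (jetP q h w) u) := by
    have hcg : ContinuousAt h z := hh0.smoothNear.continuousAt
    have hgh : ∀ᶠ w in 𝓝 z, IsLocDiffAt g (h w) :=
      hcg.eventually (by rw [hfix]; exact hg0.eventually)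
    filter_upwards [hg0.eventually, hh0.eventually, hgh,
      hg0.smoothNear.continuousAt.eventually hh'.eventually,
      eventually_eventually_nhds.2 (g.eventually_left_inverse hz)] with w h1 h2 h3 h4 h5
    rw [← lam.act_comp_of_isLocDiffAt h4 h1, ← lam.act_comp_of_isLocDiffAt h3 h2]
    congr 1
    refine jetP_congr ?_ q
    filter_upwards [h5] with y hy
    simp only [h', hy]
  have hJ : HasFDerivAt (jetP q g) (fderiv ℝ (jetP q g) z) z :=
    ((hg0.smoothNear.contDiffAt_jetP q).differentiableAt (by simp)).hasFDerivAt
  have hreg := hg0.jetP_mem_regular hq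
  have d1 := lam.velocity_act
    (HasFDerivAt.comp z (hasFDerivAt_jetP_of_jetP_eq_idJet hh'.smoothNear hid')
      hg0.smoothNear.differentiableAt.hasFDerivAt)
    (hh'.jetP_mem_regular hq)
    (lam.mdifferentiableAt_act hJ.differentiableAt hreg (mdifferentiableAt_const (c := u))) v
  have hJ' : HasFDerivAt (jetP q g) (fderiv ℝ (jetP q g) z) (h z) := by rwa [hfix]
  have hDh : fderiv ℝ h z = ContinuousLinearMap.id ℝ E := by
    rw [fderiv_eq_of_jetP_eq hh0.contDiffAt contDiff_fun_id.contDiffAt hq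
      (hid.trans (jetP_id q z).symm), fderiv_fun_id]
  have d2 := lam.velocity_act
    (HasFDerivAt.comp z hJ' hh0.smoothNear.differentiableAt.hasFDerivAt)
    (by change jetP q g (h z) ∈ _; rwa [hfix])
    (lam.mdifferentiableAt_act (hasFDerivAt_jetP_of_jetP_eq_idJet hh0.smoothNear
      hid).differentiableAt (hh0.jetP_mem_regular hq) (mdifferentiableAt_const (c := u))) v
  simp only [Function.comp_apply] at d1 d2
  rw [velocity_congr e, d2, hid', dFib_idJet, lam.velocity_act_const hJ hreg, hfix, hDh, hid,
    lam.act_id, lam.velocity_act_const (hasFDerivAt_jetP_of_jetP_eq_idJet hh0.smoothNear hid)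
      (hh0.jetP_mem_regular hq), hid] at d1
  rw [add_comm] at d1
  exact (add_right_cancel d1).symm

/-- Infinitesimal naturality of the action. The vector field `X` with jet `ξ` generates the family
`H_t = id + t X`; the identity is the derivative at `t = 0` of the action of `F_t ∘ g = g ∘ H_t`,
where `F_t = g ∘ H_t ∘ g⁻¹` is generated by the image of `X` under `g`. -/
theorem dJet_high_pushJet (hq : 0 < q) {g : OpenPartialHomeomorph E E} (hg : IsLocDiff g) {z : E}
    (hz : z ∈ g.source) (u : N) (ξ : Jet E q) :
    lam.dJet (idJet E q) (lam.act (jetP q g z) u) (pushJet g z ξ).high =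
      velocity (fun w => lam.act (jetP q g w) u) z ξ.low +
        lam.dFib (jetP q g z) u (lam.dJet (idJet E q) u ξ.high) := by
  have hg0 := hg.isLocDiffAt hz
  have hgs : IsLocDiffAt g.symm (g z) := hg.symm.isLocDiffAt (g.map_source hz)
  have hgl : g.symm (g z) = z := g.left_inv hz
  set X : E → E := taylor ξ z with hX
  have hXc : ContDiff ℝ ∞ X := contDiff_taylor ξ z
  let H : ℝ × E → E := fun p => p.2 + p.1 • X p.2
  let F : ℝ × E → E := fun p => g (H (p.1, g.symm p.2))
  have hH : ContDiff ℝ ∞ H := contDiff_snd.add (contDiff_fst.smul (hXc.comp contDiff_snd))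
  have hH0 : ∀ y, H (0, y) = y := fun y => by simp [H]
  have hHd : ∀ y, HasFDerivAt H (ContinuousLinearMap.snd ℝ ℝ E +
      (ContinuousLinearMap.fst ℝ ℝ E).smulRight (X y)) (0, y) := by
    intro y
    have h1 := (hasFDerivAt_fst (𝕜 := ℝ) (p := ((0 : ℝ), y))).smul
      (HasFDerivAt.comp ((0 : ℝ), y) (g := X) ((hXc.differentiable (by simp)) y).hasFDerivAt
        (hasFDerivAt_snd (𝕜 := ℝ) (p := ((0 : ℝ), y))))
    have h2 := (hasFDerivAt_snd (𝕜 := ℝ) (p := ((0 : ℝ), y))).add h1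
    refine h2.congr_fderiv ?_
    ext p <;> simp
  have hz0 : ContinuousAt (fun t : ℝ => H (t, z)) 0 :=
    (hH.continuous.comp (by fun_prop : Continuous fun t : ℝ => (t, z))).continuousAt
  -- the maps `H_t` are local diffeomorphisms at `z` for small `t`
  have hHt : ∀ᶠ t in 𝓝 (0 : ℝ), IsLocDiffAt (fun y => H (t, y)) z := by
    have hd : ∀ t, fderiv ℝ (fun y => H (t, y)) z =
        (fderiv ℝ H (t, z)).comp (ContinuousLinearMap.inr ℝ ℝ E) := fun t =>
      (HasFDerivAt.comp z (f := fun y => (t, y)) ((hH.differentiable (by simp)) _).hasFDerivAt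
        (hasFDerivAt_prodMk_right t z)).fderiv
    have hc : Continuous fun t : ℝ =>
        (fderiv ℝ H (t, z)).comp (ContinuousLinearMap.inr ℝ ℝ E) :=
      ((hH.continuous_fderiv (by simp)).comp
        (by fun_prop : Continuous fun t : ℝ => (t, z))).clm_comp continuous_const
    have h0 : Function.Bijective ((fderiv ℝ H (0, z)).comp (ContinuousLinearMap.inr ℝ ℝ E)) := by
      rw [(hHd z).fderiv]
      convert Function.bijective_id (α := E) using 1
      ext v; simp
    filter_upwards [hc.continuousAt.eventually (isOpen_bijective.mem_nhds h0)] with t ht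
    refine ⟨ContDiff.smoothNear (hH.comp (contDiff_prodMk_right t)) z, ?_⟩
    rw [hd t]
    exact ht
  have hgt : ∀ᶠ t in 𝓝 (0 : ℝ), IsLocDiffAt g (H (t, z)) :=
    hz0.eventually (by simp only [hH0]; exact hg0.eventually)
  have hFt : ∀ᶠ t in 𝓝 (0 : ℝ), IsLocDiffAt (fun y => F (t, y)) (g z) := by
    filter_upwards [hHt, hgt] with t h1 h2
    refine IsLocDiffAt.comp (g := g) (f := fun y => H (t, g.symm y)) ?_
      (IsLocDiffAt.comp (g := fun y => H (t, y)) (f := g.symm) ?_ hgs)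
    · rwa [hgl]
    · rwa [hgl]
  -- two ways of letting `g ∘ H_t = F_t ∘ g` act
  have e : (fun t : ℝ => lam.act (jetP q (fun y => F (t, y)) (g z)) (lam.act (jetP q g z) u))
      =ᶠ[𝓝 0] fun t =>
        lam.act (jetP q g (H (t, z))) (lam.act (jetP q (fun y => H (t, y)) z) u) := by
    filter_upwards [hHt, hgt, hFt] with t h1 h2 h3
    rw [← lam.act_comp_of_isLocDiffAt h3 hg0,
      ← lam.act_comp_of_isLocDiffAt (f := fun y => H (t, y)) h2 h1]
    congr 1
    refine jetP_congr ?_ q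
    filter_upwards [g.eventually_left_inverse hz] with y hy
    simp only [F, hy]
  have hFs : ∀ᶠ p in 𝓝 ((0 : ℝ), g z), ContDiffAt ℝ ∞ F p := by
    have hc1 : ContinuousAt (fun p : ℝ × E => g.symm p.2) (0, g z) :=
      ContinuousAt.comp (x := ((0 : ℝ), g z)) hgs.smoothNear.continuousAt continuousAt_snd
    have hc : ContinuousAt (fun p : ℝ × E => H (p.1, g.symm p.2)) (0, g z) :=
      hH.continuous.continuousAt.comp (continuousAt_fst.prodMk hc1)
    have h1 : ∀ᶠ p in 𝓝 ((0 : ℝ), g z), ContDiffAt ℝ ∞ g (H (p.1, g.symm p.2)) :=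
      hc.eventually (by simp only [hH0, hgl]; exact hg0.1)
    have h2 : ∀ᶠ p in 𝓝 ((0 : ℝ), g z), ContDiffAt ℝ ∞ g.symm p.2 :=
      continuousAt_snd.eventually hgs.1
    filter_upwards [h1, h2] with p h1 h2
    exact h1.fun_comp p (hH.contDiffAt.fun_comp p
      (contDiffAt_fst.prodMk (h2.fun_comp p contDiffAt_snd)))
  have hFder : (fun y => fderiv ℝ F (0, y) (1, 0)) =ᶠ[𝓝 (g z)]
      fun y => fderiv ℝ g (g.symm y) (X (g.symm y)) := by
    filter_upwards [g.open_target.mem_nhds (g.map_source hz)] with y hy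
    have h1 : HasFDerivAt (fun p : ℝ × E => (p.1, g.symm p.2)) _ ((0 : ℝ), y) :=
      hasFDerivAt_fst.prodMk (HasFDerivAt.comp ((0 : ℝ), y) (g := g.symm)
        (hg.symm.smoothNear hy).differentiableAt.hasFDerivAt hasFDerivAt_snd)
    have h2 : HasFDerivAt g (fderiv ℝ g (g.symm y)) (H ((0 : ℝ), g.symm y)) := by
      rw [hH0]
      exact (hg.smoothNear (g.map_target hy)).differentiableAt.hasFDerivAt
    have h3 := (HasFDerivAt.comp ((0 : ℝ), y) (g := g)
      (f := fun p : ℝ × E => H (p.1, g.symm p.2)) h2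
      (HasFDerivAt.comp ((0 : ℝ), y) (g := H) (hHd (g.symm y)) h1)).fderiv
    have h4 := DFunLike.congr_fun h3 ((1 : ℝ), (0 : E))
    refine h4.trans ?_
    simp
  have hα := (hasDerivAt_jetP_family hFs q).hasFDerivAt
  have hβ := (hasDerivAt_jetP_family (F := H) (t := 0) (x := z)
    (Filter.Eventually.of_forall fun _ => hH.contDiffAt) q).hasFDerivAt
  rw [jetP_congr hFder] at hα
  have hHX : (fun y => fderiv ℝ H (0, y) (1, 0)) = X := by
    funext y
    rw [(hHd y).fderiv]; simp
  rw [hHX, jetP_taylor] at hβ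
  have eF0 : jetP q (fun y => F (0, y)) (g z) = idJet E q := by
    rw [← jetP_id q (g z)]
    refine jetP_congr ?_ q
    filter_upwards [g.open_target.mem_nhds (g.map_source hz)] with y hy
    simp only [F, hH0, g.right_inv hy]
  have eH0 : jetP q (fun y => H (0, y)) z = idJet E q := by simp only [hH0]; exact jetP_id q z
  have hJ : HasFDerivAt (jetP q g) (fderiv ℝ (jetP q g) z) z :=
    ((hg0.smoothNear.contDiffAt_jetP q).differentiableAt (by simp)).hasFDerivAt
  have hreg := hg0.jetP_mem_regular hq
  have hJ' : HasFDerivAt (jetP q g) (fderiv ℝ (jetP q g) z) (H ((0 : ℝ), z)) := by rwa [hH0]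
  have hHz : HasFDerivAt (fun t : ℝ => H (t, z)) _ 0 :=
    HasFDerivAt.comp (0 : ℝ) (f := fun t : ℝ => (t, z)) (hHd z) (hasFDerivAt_prodMk_left (0 : ℝ) z)
  have d1 := lam.velocity_act_const hα (by rw [eF0]; exact idJet_mem_regular q)
    (lam.act (jetP q g z) u) 1
  have d2 := lam.velocity_act (HasFDerivAt.comp (0 : ℝ) hJ' hHz)
    (by simp only [Function.comp_apply, hH0]; exact hreg)
    (lam.mdifferentiableAt_act hβ.differentiableAt (by rw [eH0]; exact idJet_mem_regular q)
      (mdifferentiableAt_const (c := u))) 1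
  simp only [Function.comp_apply] at d2
  rw [velocity_congr e, d2, lam.velocity_act_const hβ (by rw [eH0]; exact idJet_mem_regular q),
    eF0, eH0, hH0, lam.act_id] at d1
  rw [lam.velocity_act_const hJ hreg]
  have hlow : X z = ξ.low := taylor_self ξ z
  simp only [ContinuousLinearMap.comp_apply, ContinuousLinearMap.inl_apply, add_apply,
    ContinuousLinearMap.smulRight_apply, ContinuousLinearMap.coe_fst',
    ContinuousLinearMap.coe_snd', ContinuousLinearMap.toSpanSingleton_apply, one_smul,
    zero_add, hlow] at d1
  exact d1.symm

end NaturalLaw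

end Action

/-! ### The fibrewise isomorphism -/

section LinearAlgebra

/-- An affine map between quotients of vector spaces, restricted to the image of an affine
subspace on which it is bijective. -/
theorem exists_affineEquiv_quotient {V V' : Type*} [AddCommGroup V] [Module ℝ V]
    [AddCommGroup V'] [Module ℝ V'] (W : Submodule ℝ V) (D : Submodule ℝ V')
    (S : AffineSubspace ℝ V) [Nonempty (S.map W.mkQ.toAffineMap)] (T : V →ₗ[ℝ] V') (c : V')
    (hW : ∀ χ ∈ W, T χ ∈ D) (hinj : ∀ χ ∈ S, ∀ χ' ∈ S, T (χ - χ') ∈ D → χ - χ' ∈ W)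
    (hsurj : ∀ σ, ∃ χ ∈ S, c + T χ = σ) :
    ∃ Ψ : S.map W.mkQ.toAffineMap ≃ᵃ[ℝ] (V' ⧸ D), ∀ χ (hχ : χ ∈ S),
      Ψ ⟨W.mkQ χ, ⟨χ, hχ, rfl⟩⟩ = Submodule.Quotient.mk (c + T χ) := by
  have hW' : W ≤ LinearMap.ker (D.mkQ ∘ₗ T) := fun χ hχ =>
    LinearMap.mem_ker.2 ((Submodule.Quotient.mk_eq_zero _).2 (hW χ hχ))
  let Φ : S.map W.mkQ.toAffineMap →ᵃ[ℝ] (V' ⧸ D) :=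
    ((W.liftQ _ hW').toAffineMap + AffineMap.const ℝ _ (D.mkQ c)).comp
      (S.map W.mkQ.toAffineMap).subtype
  have hΦ : ∀ χ (hχ : χ ∈ S),
      Φ ⟨W.mkQ χ, ⟨χ, hχ, rfl⟩⟩ = Submodule.Quotient.mk (c + T χ) := by
    intro χ hχ
    change D.mkQ (T χ) + D.mkQ c = D.mkQ _
    rw [← map_add, add_comm]
  have hbij : Function.Bijective Φ := by
    constructor
    · rintro ⟨_, χ, hχ, rfl⟩ ⟨_, χ', hχ', rfl⟩ hab
      have h1 := (hΦ χ hχ).symm.trans (hab.trans (hΦ χ' hχ'))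
      rw [Submodule.Quotient.eq, add_sub_add_left_eq_sub, ← map_sub] at h1
      exact Subtype.ext ((Submodule.Quotient.eq _).2 (hinj χ hχ χ' hχ' h1))
    · intro b
      obtain ⟨σ, rfl⟩ := Submodule.Quotient.mk_surjective _ b
      obtain ⟨χ, h3, rfl⟩ := hsurj σ
      exact ⟨_, hΦ χ h3⟩
  exact ⟨AffineEquiv.ofBijective hbij, hΦ⟩

end LinearAlgebra

/-! ### Symbol and formal Lie derivative -/

section Symbol

variable {E : Type*} [NormedAddCommGroup E] [NormedSpace ℝ E] [FiniteDimensional ℝ E]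
  {EN : Type*} [NormedAddCommGroup EN] [NormedSpace ℝ EN]
  {N : Type*} [TopologicalSpace N] [ChartedSpace EN N]

namespace NaturalLaw

variable {q : ℕ} (lam : NaturalLaw E (EN := EN) N q)

/-- The symbol `ζ ↦ L^{τμ}_k(u) ζ^k_{μ + 1_i}`, `|μ| = q`, the map through which the derivatives of
order `q + 1` of a local diffeomorphism enter the first jet of an inverse image. Its image turns
out to be the direction of the fibre of `B_1` over `u`. -/
def symbol (u : N) : SymMap E (q + 1) →ₗ[ℝ] (E →L[ℝ] TangentSpace 𝓘(ℝ, EN) u) where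
  toFun ζ := (lam.inf u).comp
    ((LinearMap.toContinuousLinearMap (Jet.high (E := E) (q := q))).comp (delta q ζ))
  map_add' ζ ζ' := by
    ext v
    simp
  map_smul' c ζ := by
    ext v
    simp

/-- The formal Lie derivative with values in the model space, like `velocity`. -/
def lieModel (s : E → N) (z : E) : Jet E q →ₗ[ℝ] EN := lam.lie s z

omit [FiniteDimensional ℝ E] in
theorem lieModel_apply (s : E → N) (z : E) (ξ : Jet E q) :
    lam.lieModel s z ξ = velocity (EN := EN) s z ξ.low - lam.dJet (idJet E q) (s z) ξ.high := rfl

theorem lie_delta (hq : 0 < q) (s : E → N) (z : E) (ζ : SymMap E (q + 1)) (v : E) :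
    lam.lie s z (delta q ζ v) = - lam.symbol (s z) ζ v := by
  have h : lam.lieModel s z (delta q ζ v) =
      - lam.dJet (idJet E q) (s z) (delta q ζ v).high := by
    rw [lieModel_apply, low_delta hq, map_zero, zero_sub]
  exact h

/-- `χ ↦ L(χ)s` on `J_q(T)`-valued 1-forms. -/
def lieForms (s : E → N) (z : E) :
    (E →L[ℝ] Jet E q) →ₗ[ℝ] (E →L[ℝ] TangentSpace 𝓘(ℝ, EN) (s z)) where
  toFun χ := LinearMap.toContinuousLinearMap (lam.lie s z ∘ₗ (χ : E →ₗ[ℝ] Jet E q))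
  map_add' χ χ' := by ext v; simp
  map_smul' c χ := by ext v; simp

theorem lieForms_apply (s : E → N) (z : E) (χ : E →L[ℝ] Jet E q) (v : E) :
    lam.lieForms s z χ v = lam.lie s z (χ v) := rfl

/-- `T* ⊗ R^0_q + δ(S_{q+1}T* ⊗ T)` consists of the `χ` with `χ_0 = 0` for which `L(χ)s` is in the
image of the symbol. -/
theorem mem_W_iff (hq : 0 < q) (s : E → N) (z : E) (χ : E →L[ℝ] Jet E q) :
    χ ∈ lam.W s z ↔ (∀ v, (χ v).low = 0) ∧
      lam.lieForms s z χ ∈ LinearMap.range (lam.symbol (s z)) := by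
  constructor
  · intro h
    obtain ⟨χ₁, h₁, _, ⟨ζ, rfl⟩, rfl⟩ := Submodule.mem_sup.1 h
    refine ⟨fun v => ?_, -ζ, ?_⟩
    · have h2 : (χ₁ v).low = 0 := (h₁ v).2
      rw [add_apply, map_add, h2, low_delta hq, add_zero]
    · ext v
      have h2 : lam.lie s z (χ₁ v) = 0 := (h₁ v).1
      rw [lieForms_apply, add_apply, map_add, h2, lie_delta lam hq, zero_add, map_neg]
      rfl
  · rintro ⟨h0, ζ, hζ⟩
    rw [show χ = (χ + delta q ζ) + delta q (-ζ) by rw [map_neg]; abel]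
    refine Submodule.add_mem_sup (fun v => ⟨?_, ?_⟩) ⟨-ζ, rfl⟩
    · change lam.lie s z (χ v + delta q ζ v) = 0
      rw [map_add, lie_delta lam hq, hζ, lieForms_apply, add_neg_cancel]
    · change Jet.low (χ v + delta q ζ v) = 0
      rw [map_add, h0, low_delta hq, add_zero]

/-- If `R_q → T` and `L` are epimorphisms, then so is `ξ ↦ (ξ_0, L(ξ)s)`, and a form `χ` with any
prescribed `χ_0` and `L(χ)s` exists. -/
theorem exists_forms (s : E → N) (z : E)
    (h1 : ∀ v, ∃ ξ ∈ lam.Rq s z, Jet.low ξ = v) (h2 : Function.Surjective (lam.lie s z))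
    (A : E →L[ℝ] E) (σ : E →L[ℝ] TangentSpace 𝓘(ℝ, EN) (s z)) :
    ∃ χ : E →L[ℝ] Jet E q, (∀ v, (χ v).low = A v) ∧ lam.lieForms s z χ = σ := by
  have hs : Function.Surjective (Jet.low.prod (lam.lie s z)) := by
    rintro ⟨v, w⟩
    obtain ⟨ξ₁, rfl⟩ := h2 w
    obtain ⟨ξ₂, h3, h4⟩ := h1 (v - Jet.low ξ₁)
    refine ⟨ξ₁ + ξ₂, Prod.ext ?_ ?_⟩
    · simp [h4]
    · simp [LinearMap.mem_ker.1 h3]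
  obtain ⟨R, hR⟩ := LinearMap.exists_rightInverse_of_surjective _ (LinearMap.range_eq_top.2 hs)
  have hR' : ∀ p, Jet.low.prod (lam.lie s z) (R p) = p := fun p => DFunLike.congr_fun hR p
  refine ⟨LinearMap.toContinuousLinearMap (R ∘ₗ (A : E →ₗ[ℝ] E).prod (σ : E →ₗ[ℝ] _)),
    fun v => congrArg Prod.fst (hR' (A v, σ v)), ?_⟩
  ext v
  exact congrArg Prod.snd (hR' (A v, σ v))

/-- The affine bijection on a fibre, for any description of the image `D` of the symbol. -/
theorem exists_affineEquiv (hq : 0 < q) (s : E → N) (z : E)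
    (h1 : ∀ v, ∃ ξ ∈ lam.Rq s z, Jet.low ξ = v) (h2 : Function.Surjective (lam.lie s z))
    {D : Submodule ℝ (E →L[ℝ] TangentSpace 𝓘(ℝ, EN) (s z))}
    (hD : D = LinearMap.range (lam.symbol (s z))) :
    ∃ Ψ : lam.A s z ≃ᵃ[ℝ] ((E →L[ℝ] TangentSpace 𝓘(ℝ, EN) (s z)) ⧸ D),
      ∀ χ (hχ : χ ∈ connections E q),
        Ψ (lam.cls s z χ hχ) = Submodule.Quotient.mk (lam.rep s z χ) := by
  have : Nonempty ((connections E q).map (lam.W s z).mkQ.toAffineMap) :=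
    inferInstanceAs (Nonempty (lam.A s z))
  refine exists_affineEquiv_quotient (lam.W s z) D (connections E q) (lam.lieForms s z) (dsec s z)
    (fun χ hχ => hD ▸ ((lam.mem_W_iff hq s z χ).1 hχ).2) (fun χ hχ χ' hχ' h => ?_) (fun σ => ?_)
  · refine (lam.mem_W_iff hq s z _).2 ⟨fun v => ?_, hD ▸ h⟩
    rw [sub_apply, map_sub, hχ v, hχ' v, sub_self]
  · obtain ⟨χ, h3, h4⟩ := lam.exists_forms s z h1 h2 (ContinuousLinearMap.id ℝ E) (σ - dsec s z)
    exact ⟨χ, h3, by rw [h4, add_sub_cancel]⟩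

theorem low_pushJet {g : OpenPartialHomeomorph E E} (hg : IsLocDiff g) {z : E}
    (hz : z ∈ g.source) (ξ : Jet E q) : (pushJet g z ξ).low = fderiv ℝ g z ξ.low := by
  have hgs := (hg.symm.smoothNear (g.map_source hz)).contDiffAt
  have hgl : g.symm (g z) = z := g.left_inv hz
  have h1 : ContDiffAt ℝ ∞ (fderiv ℝ g) (g.symm (g z)) := by
    rw [hgl]
    exact (hg.smoothNear hz).contDiffAt.fderiv_right (m := ∞) (by simp)
  have hc : ContDiffAt ℝ ∞ (fun y => fderiv ℝ g (g.symm y) (taylor ξ z (g.symm y))) (g z) :=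
    (h1.fun_comp _ hgs).clm_apply ((contDiff_taylor ξ z).contDiffAt.fun_comp _ hgs)
  refine (symDeriv_zero_apply hc _).trans ?_
  rw [hgl, taylor_self]

/-- Naturality of the formal Lie derivative. -/
theorem lie_pushJet (hq : 0 < q) {g : OpenPartialHomeomorph E E} (hg : IsLocDiff g) {z : E}
    (hz : z ∈ g.source) {s s' : E → N} (hs : ContMDiffAt 𝓘(ℝ, E) 𝓘(ℝ, EN) ∞ s z)
    (hs' : ContMDiffAt 𝓘(ℝ, E) 𝓘(ℝ, EN) ∞ s' (g z))
    (e : ∀ᶠ w in 𝓝 z, s' (g w) = lam.act (jetP q g w) (s w)) (ξ : Jet E q) :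
    lam.lieModel s' (g z) (pushJet g z ξ) =
      lam.dFib (jetP q g z) (s z) (lam.lieModel s z ξ) := by
  rw [lieModel_apply, lieModel_apply, low_pushJet hg hz,
    lam.velocity_apply_fderiv hq hg hz hs hs' e,
    e.self_of_nhds, lam.dJet_high_pushJet hq hg hz, map_sub]
  abel

/-- Compatibility of `χ ↦ j_1(s) + L(χ)s` with changes of coordinates. -/
theorem rep_pushJet_sub_mem (hq : 0 < q) {g : OpenPartialHomeomorph E E} (hg : IsLocDiff g)
    {z : E} (hz : z ∈ g.source) {z' : E} (hz' : g z = z') {s s' : E → N}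
    (hs : ContMDiffAt 𝓘(ℝ, E) 𝓘(ℝ, EN) ∞ s z) (hs' : ContMDiffAt 𝓘(ℝ, E) 𝓘(ℝ, EN) ∞ s' z')
    (e : ∀ᶠ w in 𝓝 z, s' (g w) = lam.act (jetP q g w) (s w)) {χ χ' : E →L[ℝ] Jet E q}
    (hχ : χ ∈ connections E q) {σ : E →L[ℝ] TangentSpace 𝓘(ℝ, EN) (s z)}
    {σ' : E →L[ℝ] TangentSpace 𝓘(ℝ, EN) (s' z')}
    (hχ' : ∀ v, χ' v = pushJet g z (χ (fderiv ℝ g.symm z' v)))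
    (hσ' : (⟨s' z', σ'⟩ : OneJet E (EN := EN) N) = lam.pushOneJet g z ⟨s z, σ⟩)
    (h : lam.rep s z χ - σ ∈ LinearMap.range (lam.symbol (s z))) :
    χ' ∈ connections E q ∧ lam.rep s' z' χ' - σ' ∈ LinearMap.range (lam.symbol (s' z')) := by
  subst hz'
  obtain ⟨ζ, hζ⟩ := h
  obtain ⟨ζ', hζ'⟩ := lam.dFib_symbol hq hg hz (s z) ζ
  refine ⟨fun v => ?_, ζ', ?_⟩
  · rw [hχ', low_pushJet hg hz, hχ, hg.fderiv_apply_symm hz]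
  ext v
  obtain ⟨w, rfl⟩ : ∃ w, fderiv ℝ g z w = v := ⟨_, hg.fderiv_apply_symm hz v⟩
  let τ : E →L[ℝ] EN := σ
  let τ' : E →L[ℝ] EN := σ'
  have h2 : τ' (fderiv ℝ g z w) = velocity (EN := EN) (fun w => lam.act (jetP q g w) (s z)) z w +
      lam.dFib (jetP q g z) (s z) (τ w) := by
    refine (DFunLike.congr_fun (oneJet_eq_iff.1 hσ').2 (fderiv ℝ g z w)).trans ?_
    change velocity (EN := EN) (fun w => lam.act (jetP q g w) (s z)) z
      (fderiv ℝ g.symm (g z) (fderiv ℝ g z w)) + lam.dFib (jetP q g z) (s z)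
      (τ (fderiv ℝ g.symm (g z) (fderiv ℝ g z w))) = _
    rw [hg.fderiv_symm_apply hz]
  have h4 := hζ' w
  rw [← e.self_of_nhds] at h4
  have h5 : lam.dJet (idJet E q) (s z) (delta q ζ w).high =
      velocity (EN := EN) s z w + lam.lieModel s z (χ w) - τ w := DFunLike.congr_fun hζ w
  refine h4.trans ?_
  change _ = velocity (EN := EN) s' (g z) (fderiv ℝ g z w) +
      lam.lieModel s' (g z) (χ' (fderiv ℝ g z w)) - τ' (fderiv ℝ g z w)
  rw [h5, h2, lam.velocity_apply_fderiv hq hg hz hs hs' e, hχ', hg.fderiv_symm_apply hz,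
    lam.lie_pushJet hq hg hz hs hs' e, map_sub, map_add]
  abel

end NaturalLaw

end Symbol

/-! ### The fibres of the first prolongation -/

section Prolongation

variable {E : Type*} [NormedAddCommGroup E] [NormedSpace ℝ E] [FiniteDimensional ℝ E]
  {EN : Type*} [NormedAddCommGroup EN] [NormedSpace ℝ EN]
  {N : Type*} [TopologicalSpace N] [ChartedSpace EN N]
  {X : Type*} [TopologicalSpace X] [ChartedSpace E X]
  {q : ℕ} {lam : NaturalLaw E (EN := EN) N q}

omit [FiniteDimensional ℝ E] in
theorem isLocDiff_chart_change [IsManifold 𝓘(ℝ, E) ∞ X] (e e' : Chart E X) :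
    IsLocDiff (e.1.symm.trans e'.1) := by
  have h := IsManifold.compatible_of_mem_maximalAtlas e.2 e'.2
  rw [contDiffGroupoid, mem_groupoid_of_pregroupoid] at h
  simpa [contDiffPregroupoid, IsLocDiff] using h

namespace GeometricObject

omit [FiniteDimensional ℝ E] in
theorem contMDiffAt_expr (s : GeometricObject lam X) (e : Chart E X) {z : E}
    (hz : z ∈ e.1.target) : ContMDiffAt 𝓘(ℝ, E) 𝓘(ℝ, EN) ∞ (s.expr e) z :=
  (s.smooth e).contMDiffAt (e.1.open_target.mem_nhds hz)

omit [FiniteDimensional ℝ E] in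
theorem eventually_expr_eq (s : GeometricObject lam X) (e e' : Chart E X) {x : X}
    (hx : x ∈ e.1.source) (hx' : x ∈ e'.1.source) :
    ∀ᶠ w in 𝓝 (e.1 x), s.expr e' ((e.1.symm.trans e'.1) w) =
      lam.act (jetP q (e.1.symm.trans e'.1) w) (s.expr e w) := by
  have h : e.1 x ∈ (e.1.symm.trans e'.1).source := by
    simp [hx, hx', e.1.left_inv]
  filter_upwards [(e.1.symm.trans e'.1).open_source.mem_nhds h] with w hw
  rw [OpenPartialHomeomorph.trans_source] at hw
  have := s.compat e e' (e.1.symm w) (e.1.map_target hw.1) hw.2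
  rw [e.1.right_inv hw.1] at this
  exact this

/-- If the first prolongation of the system `f_q^{-1}(ω₀) = ω₀` projects onto it, then the first
jets in `B_1` over one point of `F` are those differing from a given one by an element of the image
of the symbol. Two local diffeomorphisms `f`, `f₀` pulling `ω₀` back to the same value differ by a
solution `g` of the system; replacing `g` by a solution `g'` of the prolonged system with the same
`q`-jet changes neither the first jet of the inverse image nor the `q`-jet, and leaves
`h = f₀⁻¹ ∘ g' ∘ f` with the `q`-jet of the identity. -/
theorem b1Fibre_eq (hq : 0 < q) (ω₀ : GeometricObject lam X) (hprol : ω₀.ProlongationOnto)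
    {z : E} {e₀ : Chart E X} {f₀ : OpenPartialHomeomorph E E} (hf₀ : IsLocDiff f₀)
    (hz₀ : z ∈ f₀.source) (he₀ : f₀ z ∈ e₀.1.target) :
    ω₀.B1Fibre z (lam.pull f₀ (ω₀.expr e₀) z) =
      {σ | ∃ ζ, σ = dsec (EN := EN) (lam.pull f₀ (ω₀.expr e₀)) z + lam.symbol _ ζ} := by
  set s₀ := lam.pull f₀ (ω₀.expr e₀) with hs₀
  have hs₀c : ContMDiffAt 𝓘(ℝ, E) 𝓘(ℝ, EN) ∞ s₀ z :=
    lam.contMDiffAt_pull hq hf₀ hz₀ (ω₀.contMDiffAt_expr e₀ he₀)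
  ext σ
  constructor
  · rintro ⟨e', f, hf, hz, he', hσ⟩
    have hval : lam.pull f (ω₀.expr e') z = s₀ z := (oneJet_eq_iff.1 hσ).1.symm
    -- `g` takes the point `f z` to `f₀ z` and preserves the special section
    let g := f.symm.trans f₀
    have hg : IsLocDiff g := hf.symm.trans hf₀
    have hfl : f.symm (f z) = z := f.left_inv hz
    have hgz : f z ∈ g.source := by
      rw [OpenPartialHomeomorph.trans_source]
      exact ⟨f.map_source hz, by rw [Set.mem_preimage, hfl]; exact hz₀⟩
    have hgf : g (f z) = f₀ z := congrArg f₀ hfl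
    have hgpull : lam.pull g (ω₀.expr e₀) (f z) = ω₀.expr e' (f z) := by
      rw [lam.pull_trans hf.symm hf₀ (f.map_source hz) (by rw [hfl]; exact hz₀),
        ← lam.act_pull hf hz (ω₀.expr e'), hval]
      simp only [NaturalLaw.pull, OpenPartialHomeomorph.symm_symm, hfl, s₀]
    obtain ⟨g', hg', hg'z, hg'v, hg'j, hg'1⟩ :=
      hprol e' e₀ g (f z) he' hg hgz (by rw [hgf]; exact he₀) hgpull
    have hg'f : g' (f z) = f₀ z := hg'v.trans hgf
    -- `h = f₀⁻¹ ∘ g' ∘ f` has the `q`-jet of the identity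
    let k := f.trans g'
    have hk : IsLocDiff k := hf.trans hg'
    have hkz : z ∈ k.source := by
      rw [OpenPartialHomeomorph.trans_source]; exact ⟨hz, hg'z⟩
    let h := k.trans f₀.symm
    have hh : IsLocDiff h := hk.trans hf₀.symm
    have hkt : k z ∈ f₀.symm.source := by
      change g' (f z) ∈ f₀.target
      rw [hg'f]; exact f₀.map_source hz₀
    have hhz : z ∈ h.source := by
      rw [OpenPartialHomeomorph.trans_source]; exact ⟨hkz, hkt⟩
    have hfix : h z = z := by
      change f₀.symm (g' (f z)) = z
      rw [hg'f, f₀.left_inv hz₀]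
    have hjk : jetP q k z = jetP q f₀ z := by
      have h1 : jetP q (fun w => g' (f w)) z = jetP q (fun w => g (f w)) z :=
        jetP_comp_congr (hg.smoothNear hgz).contDiffAt (hf.smoothNear hz).contDiffAt
          (hg'.smoothNear hg'z).contDiffAt (hf.smoothNear hz).contDiffAt rfl rfl hg'j
      refine h1.trans (jetP_congr ?_ q)
      filter_upwards [f.eventually_left_inverse hz] with w hw
      exact congrArg f₀ hw
    have hid : jetP q h z = idJet E q := by
      have h2 : ContDiffAt ℝ ∞ f₀.symm (f₀ z) :=
        (hf₀.symm.smoothNear (f₀.map_source hz₀)).contDiffAt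
      have h1 : jetP q (fun w => f₀.symm (k w)) z = jetP q (fun w => f₀.symm (f₀ w)) z :=
        jetP_comp_congr h2 (hf₀.smoothNear hz₀).contDiffAt h2 (hk.smoothNear hkz).contDiffAt
          hg'f hjk rfl
      refine h1.trans ?_
      rw [jetP_congr (f₀.eventually_left_inverse hz₀), jetP_id]
    -- both inverse images agree to first order
    have hk1 : lam.pull k (ω₀.expr e₀) =ᶠ[𝓝 z] lam.pull f (lam.pull g' (ω₀.expr e₀)) := by
      filter_upwards [k.open_source.mem_nhds hkz] with w hw
      rw [OpenPartialHomeomorph.trans_source] at hw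
      exact lam.pull_trans hf hg' hw.1 hw.2 _
    have hk2 : lam.pull h s₀ =ᶠ[𝓝 z] lam.pull k (ω₀.expr e₀) := by
      filter_upwards [h.open_source.mem_nhds hhz, k.open_source.mem_nhds hkz] with w hw hw'
      rw [OpenPartialHomeomorph.trans_source] at hw
      have hwt : f₀.symm (k w) ∈ f₀.source := f₀.map_target hw.2
      rw [lam.pull_trans hk hf₀.symm hw' hw.2]
      have h3 : lam.pull f₀.symm s₀ (k w) = ω₀.expr e₀ (k w) := by
        have h4 := lam.act_pull hf₀ hwt (ω₀.expr e₀)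
        rw [f₀.right_inv hw.2] at h4
        exact h4
      exact congrArg (lam.act _) h3
    have hj : j1 (EN := EN) (lam.pull f (lam.pull g' (ω₀.expr e₀))) z =
        j1 (lam.pull f (ω₀.expr e')) z := by
      obtain ⟨h5, h6⟩ := j1_eq_j1_iff.1 hg'1
      have hc1 : ContMDiffAt 𝓘(ℝ, E) 𝓘(ℝ, EN) ∞ (lam.pull g' (ω₀.expr e₀)) (f z) :=
        lam.contMDiffAt_pull hq hg' hg'z (ω₀.contMDiffAt_expr e₀ (by rw [hg'f]; exact he₀))
      have hc2 := ω₀.contMDiffAt_expr e' he'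
      have hα : HasFDerivAt (fun w => jetP q f.symm (f w)) _ z :=
        ((((hf.symm.smoothNear (f.map_source hz)).contDiffAt_jetP q).fun_comp z
          (hf.smoothNear hz).contDiffAt).differentiableAt (by simp)).hasFDerivAt
      have hr : jetP q f.symm (f z) ∈ regular E q :=
        (hf.symm.isLocDiffAt (f.map_source hz)).jetP_mem_regular hq
      have hdf := (hf.smoothNear hz).differentiableAt
      refine j1_eq_j1_iff.2 ⟨congrArg (lam.act _) h5, ?_⟩
      ext1 v
      refine (lam.velocity_act (s := fun w => lam.pull g' (ω₀.expr e₀) (f w)) hα hr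
        ((hc1.mdifferentiableAt (by simp)).comp z hdf.mdifferentiableAt) v).trans (Eq.trans ?_
        (lam.velocity_act (s := fun w => ω₀.expr e' (f w)) hα hr
        ((hc2.mdifferentiableAt (by simp)).comp z hdf.mdifferentiableAt) v).symm)
      rw [velocity_comp (hc1.mdifferentiableAt (by simp)) hdf,
        velocity_comp (hc2.mdifferentiableAt (by simp)) hdf, h5, h6]
    have hfin : (⟨s₀ z, σ⟩ : OneJet E (EN := EN) N) = j1 (lam.pull h s₀) z := by
      rw [hσ, ← hj, ← j1_congr hk1, ← j1_congr hk2]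
    -- `lam.pull h` acts through the inverse jet of `h`, whence the sign
    refine ⟨-symDeriv (q + 1) h z, ?_⟩
    ext v
    refine (DFunLike.congr_fun (oneJet_eq_iff.1 hfin).2 v).trans ?_
    refine ((lam.velocity_pull_of_jetP_eq_idJet hq hh hhz hfix hid hs₀c).2 v).trans ?_
    rw [map_neg, sub_eq_add_neg]
    rfl
  · rintro ⟨ζ, rfl⟩
    obtain ⟨h, hh, hhz, hfix, hid, hζ⟩ := exists_isLocDiff_symDeriv_eq hq (-ζ) z
    have hz : z ∈ (h.trans f₀).source := by
      rw [OpenPartialHomeomorph.trans_source]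
      exact ⟨hhz, by rw [Set.mem_preimage, hfix]; exact hz₀⟩
    have hz' : (h.trans f₀) z = f₀ z := congrArg f₀ hfix
    refine ⟨e₀, h.trans f₀, hh.trans hf₀, hz, by rw [hz']; exact he₀, ?_⟩
    have e : lam.pull (h.trans f₀) (ω₀.expr e₀) =ᶠ[𝓝 z] lam.pull h s₀ := by
      filter_upwards [(h.trans f₀).open_source.mem_nhds hz] with w hw
      rw [OpenPartialHomeomorph.trans_source] at hw
      exact lam.pull_trans hh hf₀ hw.1 hw.2 _
    obtain ⟨h1, h2⟩ := lam.velocity_pull_of_jetP_eq_idJet hq hh hhz hfix hid hs₀c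
    rw [j1_congr e]
    refine oneJet_eq_iff.2 ⟨h1.symm, ?_⟩
    ext1 v
    refine Eq.trans ?_ (h2 v).symm
    rw [hζ, map_neg]
    change velocity (EN := EN) s₀ z v + lam.dJet (idJet E q) (s₀ z) (delta q ζ v).high =
      velocity s₀ z v - lam.dJet (idJet E q) (s₀ z) (Jet.high (- delta q ζ v))
    rw [map_neg, map_neg, sub_neg_eq_add]

/-- The fibres of `B_1` are nonempty affine spaces, directed by the image of the symbol. -/
theorem exists_affineSubspace_eq_b1Fibre (hq : 0 < q) (ω₀ : GeometricObject lam X)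
    (hprol : ω₀.ProlongationOnto) {η : GeometricObject lam X} (hreach : ω₀.Reaches η)
    (e : Chart E X) {z : E} (hz : z ∈ e.1.target) :
    ∃ S : AffineSubspace ℝ (E →L[ℝ] TangentSpace 𝓘(ℝ, EN) (η.expr e z)),
      (S : Set (E →L[ℝ] TangentSpace 𝓘(ℝ, EN) (η.expr e z))).Nonempty ∧
      (S : Set (E →L[ℝ] TangentSpace 𝓘(ℝ, EN) (η.expr e z))) = ω₀.B1Fibre z (η.expr e z) ∧
      S.direction = LinearMap.range (lam.symbol (η.expr e z)) := by
  obtain ⟨e₀, f₀, hf₀, hz₀, he₀, h⟩ := hreach e z hz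
  rw [← h, b1Fibre_eq hq ω₀ hprol hf₀ hz₀ he₀]
  refine ⟨AffineSubspace.mk' (dsec _ z) (LinearMap.range (lam.symbol _)),
    AffineSubspace.mk'_nonempty _ _, ?_, AffineSubspace.direction_mk' _ _⟩
  ext σ
  rw [SetLike.mem_coe, AffineSubspace.mem_mk', vsub_eq_sub, LinearMap.mem_range]
  exact exists_congr fun ζ => by rw [eq_sub_iff_add_eq', eq_comm]

theorem vectorSpan_b1Fibre (hq : 0 < q) (ω₀ : GeometricObject lam X)
    (hprol : ω₀.ProlongationOnto) {η : GeometricObject lam X} (hreach : ω₀.Reaches η)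
    (e : Chart E X) {z : E} (hz : z ∈ e.1.target) :
    vectorSpan ℝ (ω₀.B1Fibre z (η.expr e z)) =
      LinearMap.range (lam.symbol (η.expr e z)) := by
  obtain ⟨S, -, h, hS⟩ := ω₀.exists_affineSubspace_eq_b1Fibre hq hprol hreach e hz
  rw [← h, ← hS]
  rfl

end GeometricObject

end Prolongation

/-! ### Constancy of the rank -/

section Rank

variable {E : Type*} [NormedAddCommGroup E] [NormedSpace ℝ E] [FiniteDimensional ℝ E]
  {EN : Type*} [NormedAddCommGroup EN] [NormedSpace ℝ EN] [FiniteDimensional ℝ EN]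
  {N : Type*} [TopologicalSpace N] [ChartedSpace EN N]
  {q : ℕ} (lam : NaturalLaw E (EN := EN) N q)

namespace NaturalLaw

omit [FiniteDimensional ℝ EN] in
theorem dFib_injective (hq : 0 < q) {g : OpenPartialHomeomorph E E} (hg : IsLocDiff g) {z : E}
    (hz : z ∈ g.source) (u : N) : Function.Injective (lam.dFib (jetP q g z) u) := by
  have hr := (hg.isLocDiffAt hz).jetP_mem_regular hq
  have hr' := (hg.symm.isLocDiffAt (g.map_source hz)).jetP_mem_regular hq
  have h1 := mfderiv_comp u (lam.mdifferentiableAt_act_of_point hr' (lam.act (jetP q g z) u))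
    (lam.mdifferentiableAt_act_of_point hr u)
  have h2 : lam.act (jetP q g.symm (g z)) ∘ lam.act (jetP q g z) = id :=
    funext fun u => lam.act_jetP_symm_act hg hz u
  rw [h2, mfderiv_id] at h1
  exact Function.LeftInverse.injective
    (g := lam.dFib (jetP q g.symm (g z)) (lam.act (jetP q g z) u))
    fun v => (DFunLike.congr_fun h1 v).symm

theorem finrank_symbol_le (hq : 0 < q) {g : OpenPartialHomeomorph E E} (hg : IsLocDiff g) {z : E}
    (hz : z ∈ g.source) (u : N) :
    Module.finrank ℝ (LinearMap.range (lam.symbol u)) ≤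
      Module.finrank ℝ (LinearMap.range (lam.symbol (lam.act (jetP q g z) u))) := by
  -- the change of coordinates of `T* ⊗ V(F)`
  let T : (E →L[ℝ] EN) →ₗ[ℝ] (E →L[ℝ] EN) :=
    { toFun := fun σ => ((lam.dFib (jetP q g z) u).comp σ).comp (fderiv ℝ g.symm (g z))
      map_add' := fun σ τ => by ext v; simp
      map_smul' := fun c σ => by ext v; simp }
  have hT : Function.Injective T := by
    intro σ τ h
    ext v
    have h1 := DFunLike.congr_fun h (fderiv ℝ g z v)
    change lam.dFib _ _ (σ (fderiv ℝ g.symm (g z) (fderiv ℝ g z v))) =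
      lam.dFib _ _ (τ (fderiv ℝ g.symm (g z) (fderiv ℝ g z v))) at h1
    rw [hg.fderiv_symm_apply hz] at h1
    exact lam.dFib_injective hq hg hz u h1
  let S : N → Submodule ℝ (E →L[ℝ] EN) := fun u => LinearMap.range (lam.symbol u)
  change Module.finrank ℝ (S u) ≤ Module.finrank ℝ (S (lam.act (jetP q g z) u))
  have h1 : (S u).map T ≤ S (lam.act (jetP q g z) u) := by
    rintro _ ⟨_, ⟨ζ, rfl⟩, rfl⟩
    obtain ⟨ζ', hζ'⟩ := lam.dFib_symbol hq hg hz u ζ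
    refine ⟨ζ', ?_⟩
    ext v
    have h2 := hζ' (fderiv ℝ g.symm (g z) v)
    rw [hg.fderiv_apply_symm hz] at h2
    exact h2
  rw [LinearEquiv.finrank_eq (Submodule.equivMapOfInjective T hT (S u))]
  exact Submodule.finrank_mono h1

/-- The rank of the symbol is constant along the orbits. -/
theorem finrank_symbol_act (hq : 0 < q) {a : JetP E q} (ha : a ∈ regular E q) (u : N) :
    Module.finrank ℝ (LinearMap.range (lam.symbol (lam.act a u))) =
      Module.finrank ℝ (LinearMap.range (lam.symbol u)) := by
  obtain ⟨g, hg, hz, -, rfl⟩ := exists_isLocDiff_jetP_eq hq ha 0 0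
  refine le_antisymm ?_ (lam.finrank_symbol_le hq hg hz u)
  have := lam.finrank_symbol_le hq hg.symm (g.map_source hz) (lam.act (jetP q g 0) u)
  rwa [lam.act_jetP_symm_act hg hz] at this

/-- Where the infinitesimal action is transitive, the orbit is a neighbourhood, as `a ↦ λ(u, a)` is
then a submersion at the identity jet. -/
theorem eventually_mem_orbit [IsManifold 𝓘(ℝ, EN) ∞ N] (u : N)
    (h : Function.Surjective (lam.dJet (idJet E q) u)) :
    ∀ᶠ u' in 𝓝 u, ∃ a ∈ regular E q, lam.act a u = u' := by
  have : CompleteSpace EN := FiniteDimensional.complete ℝ EN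
  have : CompleteSpace (JetP E q) := FiniteDimensional.complete ℝ _
  let φ := chartAt EN u
  let G : JetP E q → EN := fun a => φ (lam.act a u)
  have hid := idJet_mem_regular (E := E) q
  have hact : ContMDiffAt 𝓘(ℝ, JetP E q) 𝓘(ℝ, EN) ∞ (fun a => lam.act a u) (idJet E q) :=
    (lam.contMDiffAt_act hid u).comp (idJet E q) (contMDiffAt_id.prodMk contMDiffAt_const)
  have hu : lam.act (idJet E q) u = u := lam.act_id u
  have hφ : ContMDiffAt 𝓘(ℝ, EN) 𝓘(ℝ, EN) ∞ φ (lam.act (idJet E q) u) := by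
    rw [hu]
    exact contMDiffAt_of_mem_maximalAtlas (IsManifold.chart_mem_maximalAtlas u)
      (mem_chart_source EN u)
  have hG : ContDiffAt ℝ ∞ G (idJet E q) := (hφ.comp (idJet E q) hact).contDiffAt
  have hGd : fderiv ℝ G (idJet E q) = lam.dJet (idJet E q) u := by
    rw [dJet, velocity, (hact.mdifferentiableAt (by simp)).mfderiv]
    simp only [hu, mfld_simps, fderivWithin_univ]
    rfl
  have hstrict : HasStrictFDerivAt G (lam.dJet (idJet E q) u) (idJet E q) := by
    rw [← hGd]
    exact hG.hasStrictFDerivAt (by simp)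
  have hmap := hstrict.map_nhds_eq_of_surj (LinearMap.range_eq_top.2 h)
  have hS : ∀ᶠ a in 𝓝 (idJet E q), a ∈ regular E q ∧ lam.act a u ∈ φ.source := by
    refine Filter.Eventually.and ((isOpen_regular q).mem_nhds hid)
      (hact.continuousAt.eventually ?_)
    change ∀ᶠ y in 𝓝 (lam.act (idJet E q) u), _
    rw [hu]
    exact φ.open_source.mem_nhds (mem_chart_source EN u)
  have h1 : ∀ᶠ y in 𝓝 (φ u), ∃ a, (a ∈ regular E q ∧ lam.act a u ∈ φ.source) ∧ G a = y := by
    have h2 : G (idJet E q) = φ u := congrArg φ hu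
    rw [← h2, ← hmap]
    exact Filter.image_mem_map hS
  filter_upwards [(φ.continuousAt (mem_chart_source EN u)).eventually h1,
    φ.open_source.mem_nhds (mem_chart_source EN u)] with u' h2 h3
  obtain ⟨a, ⟨h4, h5⟩, h6⟩ := h2
  exact ⟨a, h4, φ.injOn h5 h3 h6⟩

/-- The rank of `T* ⊗ R^0_q + δ(S_{q+1}T* ⊗ T)` in terms of that of the symbol: it is the kernel of
the surjection `χ ↦ (χ_0, [L(χ)s])`. -/
theorem finrank_W (hq : 0 < q) (s : E → N) (z : E)
    (h1 : ∀ v, ∃ ξ ∈ lam.Rq s z, Jet.low ξ = v) (h2 : Function.Surjective (lam.lie s z)) :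
    Module.finrank ℝ (lam.W s z) + Module.finrank ℝ (E →L[ℝ] E) + Module.finrank ℝ (E →L[ℝ] EN) =
      Module.finrank ℝ (E →L[ℝ] Jet E q) +
        Module.finrank ℝ (LinearMap.range (lam.symbol (s z))) := by
  let D : Submodule ℝ (E →L[ℝ] EN) := LinearMap.range (lam.symbol (s z))
  let L : (E →L[ℝ] Jet E q) →ₗ[ℝ] (E →L[ℝ] EN) := lam.lieForms s z
  let lowF : (E →L[ℝ] Jet E q) →ₗ[ℝ] (E →L[ℝ] E) :=
    { toFun := fun χ => LinearMap.toContinuousLinearMap (Jet.low ∘ₗ (χ : E →ₗ[ℝ] Jet E q))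
      map_add' := fun χ χ' => by ext v; simp
      map_smul' := fun c χ => by ext v; simp }
  let T := lowF.prod (D.mkQ ∘ₗ L)
  have hker : LinearMap.ker T = lam.W s z := by
    ext χ
    rw [LinearMap.mem_ker, lam.mem_W_iff hq, LinearMap.prod_apply]
    refine Prod.mk_eq_zero.trans ?_
    refine and_congr ⟨fun h v => DFunLike.congr_fun h v, fun h => ?_⟩
      (Submodule.Quotient.mk_eq_zero D)
    ext v
    exact h v
  have hT : Function.Surjective T := by
    rintro ⟨A, b⟩
    obtain ⟨σ, rfl⟩ := D.mkQ_surjective b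
    obtain ⟨χ, h3, h4⟩ := lam.exists_forms s z h1 h2 A σ
    refine ⟨χ, Prod.ext ?_ (congrArg D.mkQ h4)⟩
    ext v
    exact h3 v
  have r1 := T.finrank_range_add_finrank_ker
  rw [hker, LinearMap.range_eq_top.2 hT, finrank_top, Module.finrank_prod] at r1
  have r2 := D.finrank_quotient_add_finrank
  change _ = _ + Module.finrank ℝ D
  omega

omit [FiniteDimensional ℝ E] [FiniteDimensional ℝ EN] in
/-- Transitivity of `R_q` removes the term `ξ^r ∂_r s`, so that already the derivative of the action
is onto. -/
theorem dJet_surjective (s : E → N) (z : E)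
    (h1 : ∀ v, ∃ ξ ∈ lam.Rq s z, Jet.low ξ = v) (h2 : Function.Surjective (lam.lie s z)) :
    Function.Surjective (lam.dJet (idJet E q) (s z)) := by
  intro w
  obtain ⟨ξ₁, h3⟩ := h2 (-w : EN)
  obtain ⟨ξ₂, h4, h5⟩ := h1 (Jet.low ξ₁)
  have h6 : lam.lieModel s z (ξ₁ - ξ₂) = -w := by
    rw [map_sub, show lam.lieModel s z ξ₂ = 0 from h4, sub_zero]
    exact h3
  refine ⟨(ξ₁ - ξ₂).high, ?_⟩
  rw [lieModel_apply, map_sub, h5, sub_self, map_zero, zero_sub, neg_inj] at h6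
  exact h6

end NaturalLaw

end Rank

/-! ### Smoothness of sections -/

section Smoothness

variable {E : Type*} [NormedAddCommGroup E] [NormedSpace ℝ E]
  {EN : Type*} [NormedAddCommGroup EN] [NormedSpace ℝ EN]
  {N : Type*} [TopologicalSpace N] [ChartedSpace EN N] [IsManifold 𝓘(ℝ, EN) ∞ N]
  {P : Type*} [NormedAddCommGroup P] [NormedSpace ℝ P]

/-- The derivative at `u` of the chart of `N` at `u₀`: the coordinates in `V(F)`. As for `velocity`,
the tangent space at `u` is replaced by the model space. -/
def chartDeriv (u₀ u : N) : EN →L[ℝ] EN :=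
  mfderiv 𝓘(ℝ, EN) 𝓘(ℝ, EN) (extChartAt 𝓘(ℝ, EN) u₀) u

theorem chartDeriv_bijective {u₀ u : N} (hu : u ∈ (chartAt EN u₀).source) :
    Function.Bijective (chartDeriv (EN := EN) u₀ u) := by
  have h := isInvertible_mfderiv_extChartAt (I := 𝓘(ℝ, EN)) (x := u₀) (y := u) (by simpa using hu)
  obtain ⟨A, hA⟩ := h
  have : (chartDeriv (EN := EN) u₀ u : EN → EN) = A := by
    rw [chartDeriv, ← hA]; rfl
  rw [this]
  exact A.bijective

theorem chartDeriv_velocity {u₀ : N} {s : P → N} {p : P}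
    (hs : MDifferentiableAt 𝓘(ℝ, P) 𝓘(ℝ, EN) s p) (hu : s p ∈ (chartAt EN u₀).source) (v : P) :
    chartDeriv (EN := EN) u₀ (s p) (velocity s p v) =
      fderiv ℝ (fun w => extChartAt 𝓘(ℝ, EN) u₀ (s w)) p v := by
  have h := mfderiv_comp p ((contMDiffAt_extChartAt' (n := ∞) hu).mdifferentiableAt (by simp)) hs
  rw [mfderiv_eq_fderiv] at h
  exact (DFunLike.congr_fun h v).symm

/-- Smoothness of a vector field along `s`, tested in the chart at a fixed point. -/
theorem contMDiffAt_tangent_iff {u₀ : N} {s : P → N} {p : P}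
    (hs : ContMDiffAt 𝓘(ℝ, P) 𝓘(ℝ, EN) ∞ s p) (hu : s p ∈ (chartAt EN u₀).source)
    (τ : (p : P) → TangentSpace 𝓘(ℝ, EN) (s p)) :
    ContMDiffAt 𝓘(ℝ, P) 𝓘(ℝ, EN).tangent ∞
        (fun p => (⟨s p, τ p⟩ : TangentBundle 𝓘(ℝ, EN) N)) p ↔
      ContDiffAt ℝ ∞ (fun p => chartDeriv (EN := EN) u₀ (s p) (τ p)) p := by
  have h1 := (trivializationAt EN (TangentSpace 𝓘(ℝ, EN)) u₀).contMDiffAt_iff (n := ∞)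
    (IM := 𝓘(ℝ, P)) (IB := 𝓘(ℝ, EN))
    (f := fun p => (⟨s p, τ p⟩ : TangentBundle 𝓘(ℝ, EN) N)) (x₀ := p) (by
      rw [Bundle.Trivialization.mem_source]
      exact hu)
  refine h1.trans ((and_iff_right hs).trans (Iff.trans ?_ contMDiffAt_iff_contDiffAt))
  refine Filter.EventuallyEq.contMDiffAt_iff ?_
  filter_upwards [hs.continuousAt.eventually ((chartAt EN u₀).open_source.mem_nhds hu)] with w hw
  have h2 := TangentBundle.continuousLinearMapAt_trivializationAt (I := 𝓘(ℝ, EN)) hw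
  have h3 := DFunLike.congr_fun h2 (τ w)
  refine Eq.trans ?_ h3
  rw [Bundle.Trivialization.continuousLinearMapAt_apply,
    Bundle.Trivialization.linearMapAt_apply, if_pos]
  exact hw

namespace NaturalLaw

variable [FiniteDimensional ℝ E] {q : ℕ} (lam : NaturalLaw E (EN := EN) N q)

/-- The formal Lie derivative in the chart of `N` at `u₀`. -/
def lieChart (u₀ : N) (s : E → N) (z : E) : Jet E q →L[ℝ] EN :=
  (fderiv ℝ (fun w => extChartAt 𝓘(ℝ, EN) u₀ (s w)) z).comp
      (LinearMap.toContinuousLinearMap Jet.low) -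
    (fderiv ℝ (fun a => extChartAt 𝓘(ℝ, EN) u₀ (lam.act a (s z))) (idJet E q)).comp
      (LinearMap.toContinuousLinearMap Jet.high)

theorem lieChart_apply {u₀ : N} {s : E → N} {z : E}
    (hs : MDifferentiableAt 𝓘(ℝ, E) 𝓘(ℝ, EN) s z) (hu : s z ∈ (chartAt EN u₀).source)
    (ξ : Jet E q) :
    lam.lieChart u₀ s z ξ = chartDeriv (EN := EN) u₀ (s z) (lam.lieModel s z ξ) := by
  have h := chartDeriv_velocity (u₀ := u₀)
    (lam.mdifferentiableAt_act_of_jet (idJet_mem_regular q) (s z))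
    (by rw [lam.act_id]; exact hu) ξ.high
  rw [lam.act_id] at h
  rw [lieModel_apply, map_sub, chartDeriv_velocity hs hu, dJet, h]
  rfl

theorem contDiffAt_lieChart {u₀ : N} {s : E → N} {z : E}
    (hs : ContMDiffAt 𝓘(ℝ, E) 𝓘(ℝ, EN) ∞ s z) (hu : s z ∈ (chartAt EN u₀).source) :
    ContDiffAt ℝ ∞ (lam.lieChart u₀ s) z := by
  have h1 : ContDiffAt ℝ ∞ (fun w => extChartAt 𝓘(ℝ, EN) u₀ (s w)) z :=
    ((contMDiffAt_extChartAt' hu).comp z hs).contDiffAt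
  have h2 : ContDiffAt ℝ ∞ (Function.uncurry fun (w : E) (a : JetP E q) =>
      extChartAt 𝓘(ℝ, EN) u₀ (lam.act a (s w))) (z, idJet E q) := by
    have h3 : ContMDiffAt 𝓘(ℝ, E × JetP E q) (𝓘(ℝ, JetP E q).prod 𝓘(ℝ, EN)) ∞
        (fun r : E × JetP E q => (r.2, s r.1)) (z, idJet E q) :=
      contDiffAt_snd.contMDiffAt.prodMk
        (ContMDiffAt.comp (z, idJet E q) (g := s) (f := Prod.fst) hs contDiffAt_fst.contMDiffAt)
    have h4 : ContMDiffAt 𝓘(ℝ, E × JetP E q) 𝓘(ℝ, EN) ∞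
        (fun r : E × JetP E q => lam.act r.2 (s r.1)) (z, idJet E q) :=
      ContMDiffAt.comp (z, idJet E q) (g := fun p : JetP E q × N => lam.act p.1 p.2)
        (f := fun r : E × JetP E q => (r.2, s r.1))
        (lam.contMDiffAt_act (idJet_mem_regular q) (s z)) h3
    have h5 : ContMDiffAt 𝓘(ℝ, EN) 𝓘(ℝ, EN) ∞ (extChartAt 𝓘(ℝ, EN) u₀)
        (lam.act (idJet E q) (s z)) := by
      rw [lam.act_id]
      exact contMDiffAt_extChartAt' hu
    exact (ContMDiffAt.comp (z, idJet E q) (g := extChartAt 𝓘(ℝ, EN) u₀)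
      (f := fun r : E × JetP E q => lam.act r.2 (s r.1)) h5 h4).contDiffAt
  exact ((h1.fderiv_right (m := ∞) (by simp)).clm_comp contDiffAt_const).sub
    ((h2.fderiv (g := fun _ => idJet E q) contDiffAt_const (by simp)).clm_comp contDiffAt_const)

theorem chartDeriv_rep {u₀ : N} {s : E → N} {z : E}
    (hs : MDifferentiableAt 𝓘(ℝ, E) 𝓘(ℝ, EN) s z) (hu : s z ∈ (chartAt EN u₀).source)
    (χ : E →L[ℝ] Jet E q) (v : E) :
    chartDeriv (EN := EN) u₀ (s z) (lam.rep s z χ v) =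
      fderiv ℝ (fun w => extChartAt 𝓘(ℝ, EN) u₀ (s w)) z v + lam.lieChart u₀ s z (χ v) := by
  rw [lam.lieChart_apply hs hu, ← chartDeriv_velocity hs hu, ← map_add]
  rfl

/-- A smooth form `χ` gives a smooth section of `J_1(F)`. -/
theorem contMDiffAt_rep {s : E → N} {z : E}
    (hs : ∀ᶠ w in 𝓝 z, ContMDiffAt 𝓘(ℝ, E) 𝓘(ℝ, EN) ∞ s w) {χ : E → E →L[ℝ] Jet E q}
    (hχ : ContDiffAt ℝ ∞ χ z) (v : E) :
    ContMDiffAt 𝓘(ℝ, E) 𝓘(ℝ, EN).tangent ∞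
      (fun w => (⟨s w, lam.rep s w (χ w) v⟩ : TangentBundle 𝓘(ℝ, EN) N)) z := by
  have hs0 := hs.self_of_nhds
  have hu : s z ∈ (chartAt EN (s z)).source := mem_chart_source EN (s z)
  rw [contMDiffAt_tangent_iff hs0 hu]
  have h1 : ContDiffAt ℝ ∞ (fun w => extChartAt 𝓘(ℝ, EN) (s z) (s w)) z :=
    ((contMDiffAt_extChartAt' hu).comp z hs0).contDiffAt
  have h2 := ((h1.fderiv_right (m := ∞) (by simp)).clm_apply (contDiffAt_const (c := v))).add
    ((lam.contDiffAt_lieChart hs0 hu).clm_apply (hχ.clm_apply (contDiffAt_const (c := v))))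
  refine h2.congr_of_eventuallyEq ?_
  filter_upwards [hs, hs0.continuousAt.eventually ((chartAt EN (s z)).open_source.mem_nhds hu)]
    with w hw hw'
  exact lam.chartDeriv_rep (hw.mdifferentiableAt (by simp)) hw' _ _

/-- Every smooth section of `J_1(F)` comes locally from a smooth form `χ`: the pair
`ξ ↦ (ξ_0, L(ξ)s)` has a right inverse depending smoothly on the point. -/
theorem exists_contDiffOn_rep_eq [FiniteDimensional ℝ EN] {s : E → N} {z : E}
    (hs : ∀ᶠ w in 𝓝 z, ContMDiffAt 𝓘(ℝ, E) 𝓘(ℝ, EN) ∞ s w)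
    (h1 : ∀ v, ∃ ξ ∈ lam.Rq s z, Jet.low ξ = v) (h2 : Function.Surjective (lam.lie s z))
    (τ : (w : E) → E →L[ℝ] TangentSpace 𝓘(ℝ, EN) (s w))
    (hτ : ∀ᶠ w in 𝓝 z, ∀ v, ContMDiffAt 𝓘(ℝ, E) 𝓘(ℝ, EN).tangent ∞
      (fun w => (⟨s w, τ w v⟩ : TangentBundle 𝓘(ℝ, EN) N)) w) :
    ∃ (V : Set E) (χ : E → E →L[ℝ] Jet E q), IsOpen V ∧ z ∈ V ∧ ContDiffOn ℝ ∞ χ V ∧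
      (∀ w, χ w ∈ connections E q) ∧ ∀ w ∈ V, lam.rep s w (χ w) = τ w := by
  have hs0 := hs.self_of_nhds
  set u₀ := s z with hu₀
  have hu : s z ∈ (chartAt EN u₀).source := mem_chart_source EN (s z)
  let lowL : Jet E q →L[ℝ] E := LinearMap.toContinuousLinearMap Jet.low
  let B : E → Jet E q →L[ℝ] E × EN := fun w => lowL.prod (lam.lieChart u₀ s w)
  have hBs : Function.Surjective (B z) := by
    rintro ⟨v, y⟩
    obtain ⟨y', rfl⟩ := (chartDeriv_bijective hu).2 y
    obtain ⟨ξ₁, hξ₁⟩ := h2 y'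
    obtain ⟨ξ₂, h3, h4⟩ := h1 (v - Jet.low ξ₁)
    refine ⟨ξ₁ + ξ₂, Prod.ext ?_ ?_⟩
    · change Jet.low (ξ₁ + ξ₂) = v
      rw [map_add, h4, add_sub_cancel]
    · change lam.lieChart u₀ s z (ξ₁ + ξ₂) = _
      rw [lam.lieChart_apply (hs0.mdifferentiableAt (by simp)) hu, map_add,
        show lam.lieModel s z ξ₂ = 0 from h3, add_zero]
      exact congrArg _ hξ₁
  obtain ⟨R₀, hR₀⟩ := LinearMap.exists_rightInverse_of_surjective (B z : Jet E q →ₗ[ℝ] E × EN)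
    (LinearMap.range_eq_top.2 hBs)
  let R : E × EN →L[ℝ] Jet E q := LinearMap.toContinuousLinearMap R₀
  -- near `z` the right inverse `R` of `B z` is corrected by the inverse of `C = B ∘ R`
  let C : E → E × EN →L[ℝ] E × EN := fun w => (B w).comp R
  have hC0 : C z = ContinuousLinearMap.id ℝ (E × EN) := by
    exact ContinuousLinearMap.ext fun p => DFunLike.congr_fun hR₀ p
  let σ : E → E →L[ℝ] EN := fun w => (chartDeriv (EN := EN) u₀ (s w)).comp (τ w : E →L[ℝ] EN) -
    fderiv ℝ (fun w => extChartAt 𝓘(ℝ, EN) u₀ (s w)) w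
  let χ : E → E →L[ℝ] Jet E q := fun w =>
    R.comp ((C w).inverse.comp ((ContinuousLinearMap.id ℝ E).prod (σ w)))
  have hcomplete : CompleteSpace (E × EN) := FiniteDimensional.complete ℝ _
  -- near `z` everything is smooth and `C` is invertible
  have hB : ∀ w, ContMDiffAt 𝓘(ℝ, E) 𝓘(ℝ, EN) ∞ s w → s w ∈ (chartAt EN u₀).source →
      ContDiffAt ℝ ∞ C w := fun w h h' => by
    have hp : ContDiffAt ℝ ∞ B w := by
      have e : B = fun w => (ContinuousLinearMap.inl ℝ E EN).comp lowL +
          (ContinuousLinearMap.inr ℝ E EN).comp (lam.lieChart u₀ s w) := by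
        funext w
        ext ξ <;> simp [B]
      rw [e]
      exact contDiffAt_const.add (contDiffAt_const.clm_comp (lam.contDiffAt_lieChart h h'))
    exact hp.clm_comp contDiffAt_const
  have hinv : ∀ᶠ w in 𝓝 z, Function.Bijective (C w) := by
    refine (hB z hs0 hu).continuousAt.eventually (isOpen_bijective.mem_nhds ?_)
    rw [hC0]
    exact Function.bijective_id
  obtain ⟨V, hV, hVo, hzV⟩ := eventually_nhds_iff.1 ((hs.and hτ).and (hinv.and
    (hs0.continuousAt.eventually ((chartAt EN u₀).open_source.mem_nhds hu))))
  have hστ : ContDiffOn ℝ ∞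
      (fun w => (chartDeriv (EN := EN) u₀ (s w)).comp (τ w : E →L[ℝ] EN)) V := by
    refine contDiffOn_clm_apply.2 fun v w hw => ?_
    obtain ⟨⟨h3, h4⟩, h5, h6⟩ := hV w hw
    exact ((contMDiffAt_tangent_iff h3 h6 fun w => τ w v).1 (h4 v)).contDiffWithinAt
  have hχs : ContDiffOn ℝ ∞ χ V := by
    intro w hw
    obtain ⟨⟨h3, h4⟩, h5, h6⟩ := hV w hw
    refine ContDiffAt.contDiffWithinAt ?_
    have h7 : ContDiffAt ℝ ∞ (fun w => (C w).inverse) w := by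
      let A : (E × EN) ≃L[ℝ] E × EN :=
        (LinearEquiv.ofBijective (C w : E × EN →ₗ[ℝ] E × EN) h5).toContinuousLinearEquiv
      have h8 : ContDiffAt ℝ ∞ ContinuousLinearMap.inverse (C w) := contDiffAt_map_inverse A
      exact h8.comp w (hB w h3 h6)
    have h9 : ContDiffAt ℝ ∞ σ w := by
      have h10 : ContDiffAt ℝ ∞ (fun w => extChartAt 𝓘(ℝ, EN) u₀ (s w)) w :=
        ((contMDiffAt_extChartAt' h6).comp w h3).contDiffAt
      refine ContDiffAt.sub ?_ (h10.fderiv_right (m := ∞) (by simp))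
      exact hστ.contDiffAt (hVo.mem_nhds hw)
    have h11 : ContDiffAt ℝ ∞ (fun w => (ContinuousLinearMap.id ℝ E).prod (σ w)) w := by
      have e : (fun w => (ContinuousLinearMap.id ℝ E).prod (σ w)) = fun w =>
          ContinuousLinearMap.inl ℝ E EN + (ContinuousLinearMap.inr ℝ E EN).comp (σ w) := by
        funext w
        ext v <;> simp
      rw [e]
      exact contDiffAt_const.add (contDiffAt_const.clm_comp h9)
    exact contDiffAt_const.clm_comp (h7.clm_comp h11)
  have hBχ : ∀ w ∈ V, ∀ v, B w (χ w v) = (v, σ w v) := by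
    intro w hw v
    let A : (E × EN) ≃L[ℝ] E × EN := (LinearEquiv.ofBijective (C w : E × EN →ₗ[ℝ] E × EN)
      (hV w hw).2.1).toContinuousLinearEquiv
    have hA : C w = A := rfl
    change C w ((C w).inverse (v, σ w v)) = _
    rw [hA, ContinuousLinearMap.inverse_equiv]
    exact A.apply_symm_apply _
  -- outside `V` any form with `χ_0 = id` will do
  classical
  obtain ⟨χ₀, hχ₀⟩ := connections_nonempty (E := E) q
  refine ⟨V, fun w => if w ∈ V then χ w else χ₀, hVo, hzV,
    hχs.congr fun w hw => if_pos hw, fun w => ?_, fun w hw => ?_⟩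
  · by_cases hw : w ∈ V
    · simp only [hw, if_true]
      exact fun v => congrArg Prod.fst (hBχ w hw v)
    · simp only [hw, if_false]
      exact hχ₀
  · obtain ⟨⟨h3, h4⟩, h5, h6⟩ := hV w hw
    simp only [hw, if_true]
    ext v
    apply (chartDeriv_bijective h6).1
    rw [lam.chartDeriv_rep (h3.mdifferentiableAt (by simp)) h6]
    have h7 : lam.lieChart u₀ s w (χ w v) = σ w v := congrArg Prod.snd (hBχ w hw v)
    rw [h7]
    exact add_sub_cancel _ _

end NaturalLaw

end Smoothness

/-! ### The isomorphism of affine bundles -/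

section Isomorphism

namespace GeometricObject

variable {E : Type*} [NormedAddCommGroup E] [NormedSpace ℝ E] [FiniteDimensional ℝ E]
  {EN : Type*} [NormedAddCommGroup EN] [NormedSpace ℝ EN] [FiniteDimensional ℝ EN]
  {X : Type*} [TopologicalSpace X] [ChartedSpace E X]
  {N : Type*} [TopologicalSpace N] [ChartedSpace EN N]
  {q : ℕ} {lam : NaturalLaw E (EN := EN) N q} (ω₀ η : GeometricObject lam X)

omit [FiniteDimensional ℝ EN] in
/-- The correspondence `[χ] ↦ [j_1(η) + L(χ)η]` does not depend on the chart. -/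
theorem qcls_chart_change [IsManifold 𝓘(ℝ, E) ∞ X] (hq : 0 < q)
    (hprol : ω₀.ProlongationOnto) (hreach : ω₀.Reaches η)
    (e e' : Chart E X) {x : X} (hx : x ∈ e.1.source) (hx' : x ∈ e'.1.source)
    {χ χ' : E →L[ℝ] Jet E q} (hχ : χ ∈ connections E q)
    {σ : E →L[ℝ] TangentSpace 𝓘(ℝ, EN) (η.expr e (e.1 x))}
    {σ' : E →L[ℝ] TangentSpace 𝓘(ℝ, EN) (η.expr e' (e'.1 x))}
    (hχ' : ∀ v, χ' v = pushJet (e.1.symm.trans e'.1) (e.1 x)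
      (χ (fderiv ℝ (e.1.symm.trans e'.1).symm (e'.1 x) v)))
    (hσ' : (⟨η.expr e' (e'.1 x), σ'⟩ : OneJet E (EN := EN) N) =
      lam.pushOneJet (e.1.symm.trans e'.1) (e.1 x) ⟨η.expr e (e.1 x), σ⟩)
    (h : ω₀.qcls η e (e.1 x) (lam.rep (η.expr e) (e.1 x) χ) = ω₀.qcls η e (e.1 x) σ) :
    χ' ∈ connections E q ∧
      ω₀.qcls η e' (e'.1 x) (lam.rep (η.expr e') (e'.1 x) χ') = ω₀.qcls η e' (e'.1 x) σ' := by
  have h1 := (Submodule.Quotient.eq _).1 h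
  rw [ω₀.vectorSpan_b1Fibre hq hprol hreach e (e.1.map_source hx)] at h1
  have h2 := lam.rep_pushJet_sub_mem hq (isLocDiff_chart_change e e')
    (show e.1 x ∈ (e.1.symm.trans e'.1).source by simp [hx, hx', e.1.left_inv])
    (congrArg e'.1 (e.1.left_inv hx))
    (η.contMDiffAt_expr e (e.1.map_source hx)) (η.contMDiffAt_expr e' (e'.1.map_source hx'))
    (η.eventually_expr_eq e e' hx hx') hχ hχ' hσ' h1
  refine ⟨h2.1, (Submodule.Quotient.eq _).2 ?_⟩
  rw [ω₀.vectorSpan_b1Fibre hq hprol hreach e' (e'.1.map_source hx')]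
  exact h2.2

/-- The rank of `T* ⊗ R^0_q + δ(S_{q+1}T* ⊗ T)` is locally constant: the values of `η` near a point
lie in one orbit of the action, and on an orbit the rank of the symbol is constant. -/
theorem eventually_finrank_W_eq [IsManifold 𝓘(ℝ, EN) ∞ N] (hq : 0 < q)
    (htrans : η.Transitive) (hepi : η.Epi) (e : Chart E X) {z₀ : E} (hz₀ : z₀ ∈ e.1.target) :
    ∀ᶠ z in 𝓝 z₀, Module.finrank ℝ (lam.W (η.expr e) z) =
      Module.finrank ℝ (lam.W (η.expr e) z₀) := by
  have h0 := lam.dJet_surjective (η.expr e) z₀ (htrans e z₀ hz₀) (hepi e z₀ hz₀)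
  filter_upwards [(η.contMDiffAt_expr e hz₀).continuousAt.eventually
    (lam.eventually_mem_orbit _ h0), e.1.open_target.mem_nhds hz₀] with z hz hzt
  obtain ⟨a, ha, h1⟩ := hz
  have h2 := lam.finrank_W hq (η.expr e) z (htrans e z hzt) (hepi e z hzt)
  have h3 := lam.finrank_W hq (η.expr e) z₀ (htrans e z₀ hz₀) (hepi e z₀ hz₀)
  have h4 := lam.finrank_symbol_act hq ha (η.expr e z₀)
  rw [h1] at h4
  omega

/-- A fibrewise injective map given by `[χ] ↦ [j_1(η) + L(χ)η]` preserves and reflects smoothness of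
sections. -/
theorem smoothAtA_iff_smoothAtQ [IsManifold 𝓘(ℝ, EN) ∞ N] (htrans : η.Transitive)
    (hepi : η.Epi) (e : Chart E X) (Ψ : (z : e.1.target) → lam.A (η.expr e) z → ω₀.Q η e z)
    (hΨinj : ∀ z, Function.Injective (Ψ z))
    (hΨ : ∀ (z : e.1.target) (χ : E →L[ℝ] Jet E q) (hχ : χ ∈ connections E q),
      Ψ z (lam.cls (η.expr e) z χ hχ) = ω₀.qcls η e z (lam.rep (η.expr e) z χ))
    (c : (z : e.1.target) → lam.A (η.expr e) z) (z₀ : e.1.target) :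
    SmoothAtA η e c z₀ ↔ ω₀.SmoothAtQ η e (fun z => Ψ z (c z)) z₀ := by
  have hsm : ∀ z ∈ e.1.target, ∀ᶠ w in 𝓝 z, ContMDiffAt 𝓘(ℝ, E) 𝓘(ℝ, EN) ∞ (η.expr e) w :=
    fun z hz => by
      filter_upwards [e.1.open_target.mem_nhds hz] with w hw using η.contMDiffAt_expr e hw
  constructor
  · rintro ⟨V, χ, hχ, hV, hzV, hχs, hc⟩
    refine ⟨V, fun z => lam.rep (η.expr e) z (χ z), hV, hzV, fun v z hz => ?_, fun z hz => ?_⟩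
    · exact (lam.contMDiffAt_rep (hsm z hz.2)
        (hχs.contDiffAt ((hV.inter e.1.open_target).mem_nhds hz)) v).contMDiffWithinAt
    · exact (congrArg (Ψ z) (hc z hz)).trans (hΨ z (χ z) (hχ z))
  · rintro ⟨V, τ, hV, hzV, hτ, ht⟩
    have hτ' : ∀ᶠ w in 𝓝 (z₀ : E), ∀ v, ContMDiffAt 𝓘(ℝ, E) 𝓘(ℝ, EN).tangent ∞
        (fun w => (⟨η.expr e w, τ w v⟩ : TangentBundle 𝓘(ℝ, EN) N)) w := by
      filter_upwards [(hV.inter e.1.open_target).mem_nhds ⟨hzV, z₀.2⟩] with w hw v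
      exact (hτ v).contMDiffAt ((hV.inter e.1.open_target).mem_nhds hw)
    obtain ⟨V', χ, hV', hzV', hχs, hχ, hrep⟩ := lam.exists_contDiffOn_rep_eq (hsm z₀ z₀.2)
      (htrans e z₀ z₀.2) (hepi e z₀ z₀.2) τ hτ'
    refine ⟨V ∩ V', χ, hχ, hV.inter hV', ⟨hzV, hzV'⟩,
      hχs.mono fun w hw => hw.1.2, fun z hz => ?_⟩
    have h4 : Ψ z (lam.cls (η.expr e) z (χ z) (hχ z)) = ω₀.qcls η e z (τ z) :=
      (hΨ z (χ z) (hχ z)).trans (congrArg (ω₀.qcls η e z) (hrep z hz.2))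
    exact hΨinj z ((ht z hz.1).trans h4.symm)

omit [FiniteDimensional ℝ EN] in
theorem exists_affineEquiv (hq : 0 < q) (hprol : ω₀.ProlongationOnto)
    (hreach : ω₀.Reaches η) (htrans : η.Transitive) (hepi : η.Epi) (e : Chart E X)
    (z : e.1.target) :
    ∃ Ψ : lam.A (η.expr e) z ≃ᵃ[ℝ] ω₀.Q η e z,
      ∀ (χ : E →L[ℝ] Jet E q) (hχ : χ ∈ connections E q),
        Ψ (lam.cls (η.expr e) z χ hχ) = ω₀.qcls η e z (lam.rep (η.expr e) z χ) :=
  lam.exists_affineEquiv hq (η.expr e) z (htrans e z z.2) (hepi e z z.2)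
    (ω₀.vectorSpan_b1Fibre hq hprol hreach e z.2)

end GeometricObject

end Isomorphism

end LieEq

end

theorem theorem5p41
    {E : Type*} [NormedAddCommGroup E] [NormedSpace ℝ E] [FiniteDimensional ℝ E]
    {EN : Type*} [NormedAddCommGroup EN] [NormedSpace ℝ EN] [FiniteDimensional ℝ EN]
    {X : Type*} [TopologicalSpace X] [ChartedSpace E X] [IsManifold 𝓘(ℝ, E) ∞ X]
    {N : Type*} [TopologicalSpace N] [ChartedSpace EN N] [IsManifold 𝓘(ℝ, EN) ∞ N]
    {q : ℕ} (hq : 0 < q)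
    (lam : LieEq.NaturalLaw E (EN := EN) N q)
    (ω₀ η : LieEq.GeometricObject lam X)
    (hprol : ω₀.ProlongationOnto)
    (hreach : ω₀.Reaches η)
    (htrans : η.Transitive)
    (hepi : η.Epi) :
    (∀ (e : LieEq.Chart E X) (z : e.1.target),
      ∃ S : AffineSubspace ℝ (E →L[ℝ] TangentSpace 𝓘(ℝ, EN) (η.expr e z)),
        (S : Set (E →L[ℝ] TangentSpace 𝓘(ℝ, EN) (η.expr e z))).Nonempty ∧
        (S : Set (E →L[ℝ] TangentSpace 𝓘(ℝ, EN) (η.expr e z))) =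
          ω₀.B1Fibre z (η.expr e z)) ∧
    (∀ (e : LieEq.Chart E X), ∀ z₀ ∈ e.1.target, ∀ᶠ z in 𝓝 z₀,
      Module.finrank ℝ (lam.W (η.expr e) z) = Module.finrank ℝ (lam.W (η.expr e) z₀)) ∧
    ∃ Ψ : (e : LieEq.Chart E X) → (z : e.1.target) →
        lam.A (η.expr e) z ≃ᵃ[ℝ] ω₀.Q η e z,
      (∀ (e : LieEq.Chart E X) (z : e.1.target) (χ : E →L[ℝ] LieEq.Jet E q)
        (hχ : χ ∈ LieEq.connections E q),
        Ψ e z (lam.cls (η.expr e) z χ hχ) = ω₀.qcls η e z (lam.rep (η.expr e) z χ)) ∧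
      (∀ (e e' : LieEq.Chart E X) (x : X) (hx : x ∈ e.1.source) (hx' : x ∈ e'.1.source)
        (χ χ' : E →L[ℝ] LieEq.Jet E q) (hχ : χ ∈ LieEq.connections E q)
        (σ : E →L[ℝ] TangentSpace 𝓘(ℝ, EN) (η.expr e (e.1 x)))
        (σ' : E →L[ℝ] TangentSpace 𝓘(ℝ, EN) (η.expr e' (e'.1 x))),
        (∀ v, χ' v = LieEq.pushJet (e.1.symm.trans e'.1) (e.1 x)
          (χ (fderiv ℝ (e.1.symm.trans e'.1).symm (e'.1 x) v))) →
        (⟨η.expr e' (e'.1 x), σ'⟩ : LieEq.OneJet E (EN := EN) N) =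
          lam.pushOneJet (e.1.symm.trans e'.1) (e.1 x) ⟨η.expr e (e.1 x), σ⟩ →
        Ψ e ⟨e.1 x, e.1.map_source hx⟩ (lam.cls (η.expr e) (e.1 x) χ hχ) =
          ω₀.qcls η e (e.1 x) σ →
        ∃ hχ' : χ' ∈ LieEq.connections E q,
          Ψ e' ⟨e'.1 x, e'.1.map_source hx'⟩ (lam.cls (η.expr e') (e'.1 x) χ' hχ') =
            ω₀.qcls η e' (e'.1 x) σ') ∧
      (∀ (e : LieEq.Chart E X) (c : (z : e.1.target) → lam.A (η.expr e) z) (z₀ : e.1.target),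
        LieEq.GeometricObject.SmoothAtA η e c z₀ ↔
          ω₀.SmoothAtQ η e (fun z => Ψ e z (c z)) z₀) := by
  choose Ψ hΨ using ω₀.exists_affineEquiv η hq hprol hreach htrans hepi
  refine ⟨fun e z => ?_, fun e z₀ hz₀ => η.eventually_finrank_W_eq hq htrans hepi e hz₀,
    Ψ, hΨ, fun e e' x hx hx' χ χ' hχ σ σ' hχ' hσ' h => ?_, fun e c z₀ =>
      ω₀.smoothAtA_iff_smoothAtQ η htrans hepi e (fun z => Ψ e z)
        (fun z => (Ψ e z).injective) (hΨ e) c z₀⟩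
  · obtain ⟨S, h1, h2, -⟩ := ω₀.exists_affineSubspace_eq_b1Fibre hq hprol hreach e z.2
    exact ⟨S, h1, h2⟩
  · have h1 : ω₀.qcls η e (e.1 x) (lam.rep (η.expr e) (e.1 x) χ) = ω₀.qcls η e (e.1 x) σ :=
      (hΨ e ⟨e.1 x, e.1.map_source hx⟩ χ hχ).symm.trans h
    have h2 := ω₀.qcls_chart_change η hq hprol hreach e e' hx hx' hχ hχ' hσ' h1
    exact ⟨h2.1, (hΨ e' ⟨e'.1 x, e'.1.map_source hx'⟩ χ' h2.1).trans h2.2⟩
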